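/- Let $n\ge 2$, $0\le k\le n$ and $\mathbb{R}^n_+=\mathbb{R}^{n-1}\times(0,\infty)$. Let $\Lambda=\Lambda^0\oplus\cdots\oplus\Lambda^n$ be the complexified exterior algebra of $\mathbb{R}^n$ with its Hermitian inner product, with orthonormal basis $\mathrm{d}x_{\ell_1}\wedge\cdots\wedge \mathrm{d}x_{\ell_j}$, $\ell_1<\cdots<\ell_j$, $0\le j\le n$; put $\Lambda^{\ell}=\{0\}$ for $\ell<0$ or $\ell>n$. Let $\mathrm{d}=\sum_j \partial_{x_j}\mathfrak{e}_j\wedge$ and $\delta=-\sum_j\partial_{x_j}\mathfrak{e}_j\lrcorner$ act in the sense of distributions on $\mathbb{R}^n_+$, and regard them as unbounded operators on $\mathrm{L}^2(\mathbb{R}^n_+,\Lambda)$ with the maximal domains $\{u\in \mathrm{L}^2:\mathrm{d}u\in \mathrm{L}^2\}$ and $\{u\in \mathrm{L}^2:\delta u\in \mathrm{L}^2\}$. Let $\mathrm{d}^*$ and $\delta^*$ be their Hilbert space adjoints. For $A\in\{\mathrm{d},\mathrm{d}^*,\delta,\delta^*\}$ let $\mathrm{N}_2(A,\Lambda^k)=\{u\in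 \mathrm{D}(A)\cap \mathrm{L}^2(\mathbb{R}^n_+,\Lambda^k): Au=0\}$, and let $\mathrm{R}_2(A,\Lambda^k)$ be the range of $A$ in $\mathrm{L}^2(\mathbb{R}^n_+,\Lambda^k)$, that is, the image under $A$ of the forms in $\mathrm{D}(A)$ of degree $k-1$ if $A\in\{\mathrm{d},\delta^*\}$, and of degree $k+1$ if $A\in\{\mathrm{d}^*,\delta\}$. Let $-\Delta_{\mathcal{H},\mathfrak{t}}=(\mathrm{d}+\mathrm{d}^*)^2$ and $-\Delta_{\mathcal{H},\mathfrak{n}}=(\delta^*+\delta)^2$, with their natural domains, be the negative Hodge Laplacians. Both have an injective non-negative self-adjoint square root $(-\Delta_{\mathcal{H},\cdot})^{1/2}$, whose inverse is denoted by $(-\Delta_{\mathcal{H},\cdot})^{-1/2}$. Let $\mathbb{P}$ and $\mathbb{Q}$ be the orthogonal projectors of $\mathrm{L}^2(\mathbb{R}^n_+,\Lambda^k)$ onto $\mathrm{N}_2(\mathrm{d}^*,\Lambda^k)$ and $\mathrm{N}_2(\delta,\Lambda^k)$. Then the following hold. 1. $\mathrm{N}_2(\mathrm{d},\Lambda^k)=\overline{\mathrm{R}_2(\mathrm{d},\Lambda^k)}$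 and $\mathrm{N}_2(\mathrm{d}^*,\Lambda^k)=\overline{\mathrm{R}_2(\mathrm{d}^*,\Lambda^k)}$, with closures in $\mathrm{L}^2$. 2. The operators $\mathrm{d}(-\Delta_{\mathcal{H},\mathfrak{t}})^{-1/2}$ and $\mathrm{d}^*(-\Delta_{\mathcal{H},\mathfrak{t}})^{-1/2}$ are densely defined and extend by closure to bounded operators on $\mathrm{L}^2(\mathbb{R}^n_+,\Lambda)$, the projector $\mathbb{P}$ is well defined, and, with these extensions, on $\mathrm{L}^2(\mathbb{R}^n_+,\Lambda^k)$ $$\mathbb{P}=\mathrm{I}-\mathrm{d}(-\Delta_{\mathcal{H},\mathfrak{t}})^{-\frac12}\,\mathrm{d}^*(-\Delta_{\mathcal{H},\mathfrak{t}})^{-\frac12}.$$ 3. $\mathrm{L}^2(\mathbb{R}^n_+,\Lambda^k)=\mathrm{N}_2(\mathrm{d}^*,\Lambda^k)\overset{\perp}{\oplus}\mathrm{N}_2(\mathrm{d},\Lambda^k)$. Moreover, 1, 2 and 3 remain true with $(\mathfrak{t},\mathrm{d},\mathrm{d}^*,\mathbb{P})$ replaced by $(\mathfrak{n},\delta^*,\delta,\mathbb{Q})$.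 -/

import Mathlib

open MeasureTheory
open scoped ContDiff

noncomputable section

namespace HodgeHalfSpace

/-! ### Complexified exterior algebra of `ℝⁿ` in coordinates -/

/-- The open half-space `ℝⁿ₊ = ℝ^(n-1) × (0, ∞)`: the last coordinate is positive. -/
def halfSpace (n : ℕ) : Set (EuclideanSpace ℝ (Fin n)) :=
  {x | ∀ i : Fin n, (i : ℕ) + 1 = n → 0 < x i}

/-- The complexified exterior algebra `Λ = Λ⁰ ⊕ ⋯ ⊕ Λⁿ` of `ℝⁿ`.  The form `∑_I u_I dx_I`, with
`dx_I = dx_{ℓ₁} ∧ ⋯ ∧ dx_{ℓ_k}` for `I = {ℓ₁ < ⋯ < ℓ_k}`, is stored as the family `(u_I)_I`, and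
`(dx_I)_I` is orthonormal for the Hermitian inner product. -/
abbrev Form (n : ℕ) : Type := EuclideanSpace ℂ (Finset (Fin n))

/-- The sign in `e_j ∧ dx_I = ± dx_{I ∪ {j}}` for `j ∉ I`. -/
def sgn {n : ℕ} (j : Fin n) (I : Finset (Fin n)) : ℂ := (-1) ^ (I.filter (· < j)).card

/-- The exterior product `u ↦ e_j ∧ u`. -/
def wedge {n : ℕ} (j : Fin n) : Form n →ₗ[ℂ] Form n where
  toFun u := WithLp.toLp 2 fun J => if j ∈ J then sgn j (J.erase j) * u (J.erase j) else 0
  map_add' u v := by ext J; by_cases h : j ∈ J <;> simp [h, mul_add]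
  map_smul' c u := by ext J; by_cases h : j ∈ J <;> simp [h, mul_left_comm]

/-- The interior product `u ↦ e_j ⌟ u`, the adjoint of `u ↦ e_j ∧ u`. -/
def contract {n : ℕ} (j : Fin n) : Form n →ₗ[ℂ] Form n where
  toFun u := WithLp.toLp 2 fun I => if j ∈ I then 0 else sgn j I * u (insert j I)
  map_add' u v := by ext J; by_cases h : j ∈ J <;> simp [h, mul_add]
  map_smul' c u := by ext J; by_cases h : j ∈ J <;> simp [h, mul_left_comm]

theorem inner_wedge_left {n : ℕ} (j : Fin n) (u v : Form n) :
    inner ℂ (wedge j u) v = inner ℂ u (contract j v) := by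
  simp only [PiLp.inner_apply, wedge, contract, LinearMap.coe_mk, AddHom.coe_mk]
  rw [← Finset.sum_filter_add_sum_filter_not Finset.univ (fun J => j ∈ J)]
  rw [← Finset.sum_filter_add_sum_filter_not (s := Finset.univ) (p := fun J => j ∈ J)
    (f := fun i => inner ℂ (u.ofLp i) _)]
  have e1 : ∀ f : Finset (Fin n) → ℂ,
      (∑ x with j ∉ x, inner ℂ (if j ∈ x then f x else 0) (v x)) = 0 := by
    intro f; refine Finset.sum_eq_zero fun x hx => ?_
    simp [(Finset.mem_filter.1 hx).2]
  rw [e1, add_zero]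
  rw [Finset.sum_eq_zero (s := Finset.univ.filter (fun J => j ∈ J))
    (f := fun i => inner ℂ (u.ofLp i) _), zero_add]
  · refine Finset.sum_bij' (fun J _ => J.erase j) (fun J _ => insert j J) ?_ ?_ ?_ ?_ ?_
    · simp
    · simp
    · intro a ha; exact Finset.insert_erase (Finset.mem_filter.1 ha).2
    · intro a ha; exact Finset.erase_insert (Finset.mem_filter.1 ha).2
    · intro a ha
      have h := (Finset.mem_filter.1 ha).2
      simp [h, sgn, Finset.insert_erase h]; ring
  · intro x hx; simp [(Finset.mem_filter.1 hx).2]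

/-- The classical exterior derivative `dφ = ∑_j e_j ∧ ∂_j φ`. -/
def extDiff {n : ℕ} (φ : EuclideanSpace ℝ (Fin n) → Form n) (x : EuclideanSpace ℝ (Fin n)) :
    Form n :=
  ∑ j, wedge j (fderiv ℝ φ x (EuclideanSpace.single j 1))

/-- The classical interior derivative `δφ = - ∑_j e_j ⌟ ∂_j φ`. -/
def coDiff {n : ℕ} (φ : EuclideanSpace ℝ (Fin n) → Form n) (x : EuclideanSpace ℝ (Fin n)) :
    Form n :=
  -∑ j, contract j (fderiv ℝ φ x (EuclideanSpace.single j 1))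

/-! ### Forms in `L²` and the weak derivatives -/

/-- Lebesgue measure on the half-space. -/
abbrev hMeasure (n : ℕ) : Measure (EuclideanSpace ℝ (Fin n)) := volume.restrict (halfSpace n)

/-- `L²(ℝⁿ₊, Λ)`. -/
abbrev L2Form (n : ℕ) : Type := Lp (Form n) 2 (hMeasure n)

/-- `L²(ℝⁿ₊, Λ^k)` as a subspace of `L²(ℝⁿ₊, Λ)`; the degree `k` is an integer, and the subspace is
`{0}` if `k < 0` or `k > n`. -/
def L2Deg (n : ℕ) (k : ℤ) : Submodule ℂ (L2Form n) where
  carrier := {u | ∀ I : Finset (Fin n), (I.card : ℤ) ≠ k → ∀ᵐ x ∂(hMeasure n), u x I = 0}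
  zero_mem' := by
    intro I _
    filter_upwards [Lp.coeFn_zero (Form n) 2 (hMeasure n)] with x hx
    rw [hx]; rfl
  add_mem' := by
    intro u v hu hv I hI
    filter_upwards [Lp.coeFn_add u v, hu I hI, hv I hI] with x hx h1 h2
    rw [hx, Pi.add_apply, PiLp.add_apply, h1, h2, add_zero]
  smul_mem' := by
    intro c u hu I hI
    filter_upwards [Lp.coeFn_smul c u, hu I hI] with x hx h1
    rw [hx, Pi.smul_apply, PiLp.smul_apply, h1, smul_zero]

/-- Test forms: elements of `C_c^∞(ℝⁿ₊, Λ)`. -/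
structure IsTestForm {n : ℕ} (φ : EuclideanSpace ℝ (Fin n) → Form n) : Prop where
  smooth : ContDiff ℝ ∞ φ
  compact : HasCompactSupport φ
  support : tsupport φ ⊆ halfSpace n

/-- `w = du` in the sense of distributions on `ℝⁿ₊`: `⟨u, δφ⟩ = ⟨w, φ⟩` for all test forms `φ`. -/
def IsWeakD {n : ℕ} (u w : L2Form n) : Prop :=
  ∀ φ : EuclideanSpace ℝ (Fin n) → Form n, IsTestForm φ →
    ∫ x in halfSpace n, inner ℂ (coDiff φ x) (u x) = ∫ x in halfSpace n, inner ℂ (φ x) (w x)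

/-- `w = δu` in the sense of distributions on `ℝⁿ₊`: `⟨u, dφ⟩ = ⟨w, φ⟩` for all test forms `φ`. -/
def IsWeakCoD {n : ℕ} (u w : L2Form n) : Prop :=
  ∀ φ : EuclideanSpace ℝ (Fin n) → Form n, IsTestForm φ →
    ∫ x in halfSpace n, inner ℂ (extDiff φ x) (u x) = ∫ x in halfSpace n, inner ℂ (φ x) (w x)

theorem IsTestForm.memLp {n : ℕ} {φ : EuclideanSpace ℝ (Fin n) → Form n} (h : IsTestForm φ) :
    MemLp φ 2 (hMeasure n) :=
  (h.smooth.continuous.memLp_of_hasCompactSupport h.compact).restrict _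

theorem memLp_deriv {n : ℕ} {φ : EuclideanSpace ℝ (Fin n) → Form n} (h : IsTestForm φ)
    (A : Form n →ₗ[ℂ] Form n) (v : EuclideanSpace ℝ (Fin n)) :
    MemLp (fun x => A (fderiv ℝ φ x v)) 2 (hMeasure n) := by
  have h1 : Continuous (fun x => fderiv ℝ φ x v) :=
    (h.smooth.continuous_fderiv (by simp)).clm_apply continuous_const
  have hA : Continuous A := A.continuous_of_finiteDimensional
  refine MemLp.restrict _ ((hA.comp h1).memLp_of_hasCompactSupport ?_)
  refine HasCompactSupport.comp_left (g := A) ?_ (map_zero A)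
  exact h.compact.fderiv_apply ℝ v

theorem IsTestForm.memLp_extDiff {n : ℕ} {φ : EuclideanSpace ℝ (Fin n) → Form n}
    (h : IsTestForm φ) : MemLp (extDiff φ) 2 (hMeasure n) :=
  memLp_finsetSum (f := fun j x => wedge j (fderiv ℝ φ x (EuclideanSpace.single j 1)))
    Finset.univ fun j _ => memLp_deriv h (wedge j) _

theorem IsTestForm.memLp_coDiff {n : ℕ} {φ : EuclideanSpace ℝ (Fin n) → Form n}
    (h : IsTestForm φ) : MemLp (coDiff φ) 2 (hMeasure n) :=
  (memLp_finsetSum (f := fun j x => contract j (fderiv ℝ φ x (EuclideanSpace.single j 1)))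
    Finset.univ fun j _ => memLp_deriv h (contract j) _).neg

theorem integral_inner_eq {n : ℕ} {f : EuclideanSpace ℝ (Fin n) → Form n}
    (hf : MemLp f 2 (hMeasure n)) (u : L2Form n) :
    ∫ x in halfSpace n, inner ℂ (f x) (u x) = inner ℂ (hf.toLp f) u := by
  rw [L2.inner_def]
  refine integral_congr_ae ?_
  filter_upwards [hf.coeFn_toLp] with x hx
  rw [hx]

theorem isWeakD_iff {n : ℕ} {u w : L2Form n} : IsWeakD u w ↔
    ∀ (φ : EuclideanSpace ℝ (Fin n) → Form n) (h : IsTestForm φ),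
      inner ℂ (h.memLp_coDiff.toLp _) u = inner ℂ (h.memLp.toLp _) w :=
  forall₂_congr fun φ h => by rw [integral_inner_eq h.memLp_coDiff, integral_inner_eq h.memLp]

theorem isWeakCoD_iff {n : ℕ} {u w : L2Form n} : IsWeakCoD u w ↔
    ∀ (φ : EuclideanSpace ℝ (Fin n) → Form n) (h : IsTestForm φ),
      inner ℂ (h.memLp_extDiff.toLp _) u = inner ℂ (h.memLp.toLp _) w :=
  forall₂_congr fun φ h => by rw [integral_inner_eq h.memLp_extDiff, integral_inner_eq h.memLp]

theorem halfSpace_isOpen (n : ℕ) : IsOpen (halfSpace n) := by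
  have : halfSpace n = ⋂ i : Fin n, {x | (i : ℕ) + 1 = n → 0 < x i} := by
    ext x; simp [halfSpace]
  rw [this]
  refine isOpen_iInter_of_finite fun i => ?_
  by_cases h : (i : ℕ) + 1 = n
  · simp only [h, true_imp_iff]
    exact isOpen_lt continuous_const (by fun_prop)
  · simp [h]

/-- The fundamental lemma of the calculus of variations, which makes weak derivatives unique. -/
theorem eq_zero_of_forall_testForm {n : ℕ} {w : L2Form n}
    (hw : ∀ φ : EuclideanSpace ℝ (Fin n) → Form n, IsTestForm φ →
      ∫ x in halfSpace n, inner ℂ (φ x) (w x) = 0) : w = 0 := by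
  have key : ∀ I : Finset (Fin n), ∀ᵐ x ∂(hMeasure n), w x I = 0 := by
    intro I
    rw [ae_restrict_iff' (halfSpace_isOpen n).measurableSet]
    refine (halfSpace_isOpen n).ae_eq_zero_of_integral_contDiff_smul_eq_zero ?_ ?_
    · have h1 : MemLp (fun x => w x I) 2 (hMeasure n) := by
        have := Lp.memLp w
        exact (EuclideanSpace.proj (𝕜 := ℂ) I).comp_memLp' this
      intro x _
      obtain ⟨s, hs, hi⟩ := h1.locallyIntegrable (by norm_num) x
      refine ⟨s ∩ halfSpace n,
        Filter.inter_mem (mem_nhdsWithin_of_mem_nhds hs) self_mem_nhdsWithin, ?_⟩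
      rwa [IntegrableOn, Measure.restrict_restrict₀'
        (halfSpace_isOpen n).measurableSet.nullMeasurableSet] at hi
    · intro g g1 g2 g3
      have := hw (fun x => EuclideanSpace.single I (g x : ℂ)) ⟨?_, ?_, ?_⟩
      · rw [← setIntegral_eq_integral_of_forall_compl_eq_zero (s := halfSpace n), ← this]
        · refine integral_congr_ae (Filter.Eventually.of_forall fun x => ?_)
          simp [EuclideanSpace.inner_single_left]
        · intro x hx
          rw [image_eq_zero_of_notMem_tsupport fun h => hx (g3 h), zero_smul]
      · change ContDiff ℝ ∞ (fun x => (WithLp.toLp 2 (Pi.single I (g x : ℂ)) : Form n))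
        refine (PiLp.contDiff_toLp (𝕜 := ℝ) (p := 2)).comp (contDiff_pi.2 ?_)
        intro J
        by_cases h : J = I
        · subst h; simp only [Pi.single_eq_same]; exact Complex.ofRealCLM.contDiff.comp g1
        · simp only [Pi.single_apply, h, if_false]; exact contDiff_const
      · exact g2.comp_left (g := fun t : ℝ => (EuclideanSpace.single I (t : ℂ) : Form n)) (by simp)
      · exact (tsupport_comp_subset (g := fun t : ℝ => (EuclideanSpace.single I (t : ℂ) : Form n))
          (by simp) g).trans g3
  rw [Lp.eq_zero_iff_ae_eq_zero]
  filter_upwards [ae_all_iff.2 key] with x hx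
  ext I; simpa using hx I

/-- The graph of the weak exterior derivative. -/
def dGraph (n : ℕ) : Submodule ℂ (L2Form n × L2Form n) where
  carrier := {p | IsWeakD p.1 p.2}
  zero_mem' := by simp [isWeakD_iff]
  add_mem' := by
    intro p q hp hq
    simp only [Set.mem_ofPred_eq, isWeakD_iff, Prod.fst_add, Prod.snd_add, inner_add_right] at *
    intro φ h
    rw [hp φ h, hq φ h]
  smul_mem' := by
    intro c p hp
    simp only [Set.mem_ofPred_eq, isWeakD_iff, Prod.smul_fst, Prod.smul_snd, inner_smul_right] at *
    intro φ h
    rw [hp φ h]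

/-- The graph of the weak interior derivative. -/
def deltaGraph (n : ℕ) : Submodule ℂ (L2Form n × L2Form n) where
  carrier := {p | IsWeakCoD p.1 p.2}
  zero_mem' := by simp [isWeakCoD_iff]
  add_mem' := by
    intro p q hp hq
    simp only [Set.mem_ofPred_eq, isWeakCoD_iff, Prod.fst_add, Prod.snd_add, inner_add_right] at *
    intro φ h
    rw [hp φ h, hq φ h]
  smul_mem' := by
    intro c p hp
    simp only [Set.mem_ofPred_eq, isWeakCoD_iff, Prod.smul_fst, Prod.smul_snd,
      inner_smul_right] at *
    intro φ h
    rw [hp φ h]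

/-- The unbounded operator `(D₂(d), d)` on `L²(ℝⁿ₊, Λ)`, where `D₂(d)` is the space of all
`u ∈ L²` with `du ∈ L²`. -/
def dOp (n : ℕ) : L2Form n →ₗ.[ℂ] L2Form n := (dGraph n).toLinearPMap

/-- The unbounded operator `(D₂(δ), δ)` on `L²(ℝⁿ₊, Λ)`, where `D₂(δ)` is the space of all
`u ∈ L²` with `δu ∈ L²`. -/
def deltaOp (n : ℕ) : L2Form n →ₗ.[ℂ] L2Form n := (deltaGraph n).toLinearPMap

theorem mem_graph_d {n : ℕ} (p : L2Form n × L2Form n) :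
    p ∈ (dOp n).graph ↔ IsWeakD p.1 p.2 := by
  rw [dOp, Submodule.toLinearPMap_graph_eq]
  · rfl
  intro p hp h0
  refine eq_zero_of_forall_testForm fun φ h => ?_
  have h2 : IsWeakD p.1 p.2 := hp
  rw [isWeakD_iff, h0] at h2
  rw [integral_inner_eq h.memLp, ← h2 φ h, inner_zero_right]

theorem mem_graph_delta {n : ℕ} (p : L2Form n × L2Form n) :
    p ∈ (deltaOp n).graph ↔ IsWeakCoD p.1 p.2 := by
  rw [deltaOp, Submodule.toLinearPMap_graph_eq]
  · rfl
  intro p hp h0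
  refine eq_zero_of_forall_testForm fun φ h => ?_
  have h2 : IsWeakCoD p.1 p.2 := hp
  rw [isWeakCoD_iff, h0] at h2
  rw [integral_inner_eq h.memLp, ← h2 φ h, inner_zero_right]

/-- The Hilbert space adjoint `d*` of `(D₂(d), d)`. -/
def dStar (n : ℕ) : L2Form n →ₗ.[ℂ] L2Form n := (dOp n).adjoint

/-- The Hilbert space adjoint `δ*` of `(D₂(δ), δ)`. -/
def deltaStar (n : ℕ) : L2Form n →ₗ.[ℂ] L2Form n := (deltaOp n).adjoint

/-- `N₂(A, Λ^k)`: the forms `u ∈ D(A)` of degree `k` with `A u = 0`. -/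
def nullForms {n : ℕ} (A : L2Form n →ₗ.[ℂ] L2Form n) (k : ℤ) : Submodule ℂ (L2Form n) :=
  (LinearMap.ker A.toFun).map A.domain.subtype ⊓ L2Deg n k

/-- The image under `A` of the forms of degree `j` in `D(A)`.  Hence `R₂(A, Λ^k)`, the range of `A`
in `L²(ℝⁿ₊, Λ^k)`, is `imageForms A (k - 1)` for `A = d, δ*` (which raise the degree by one) and
`imageForms A (k + 1)` for `A = d*, δ` (which lower it by one). -/
def imageForms {n : ℕ} (A : L2Form n →ₗ.[ℂ] L2Form n) (j : ℤ) : Submodule ℂ (L2Form n) :=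
  ((L2Deg n j).comap A.domain.subtype).map A.toFun

/-! ### Unbounded operators: composition, square root, Hodge Laplacians -/

section Abstract

variable {H : Type*} [NormedAddCommGroup H] [InnerProductSpace ℂ H]

/-- The composition `S T` on its natural domain `{x ∈ D(T) | T x ∈ D(S)}`. -/
def opComp (S T : H →ₗ.[ℂ] H) : H →ₗ.[ℂ] H where
  domain := (S.domain.comap T.toFun).map T.domain.subtype
  toFun :=
    { toFun := fun x => S ⟨T ⟨x, by obtain ⟨_, y, _, rfl⟩ := x; exact y.2⟩, by
        obtain ⟨_, y, hy, rfl⟩ := x; exact hy⟩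
      map_add' := by
        intro x y
        rw [← S.map_add]
        congr 1
        ext
        exact T.map_add ⟨x, _⟩ ⟨y, _⟩
      map_smul' := by
        intro c x
        rw [RingHom.id_apply, ← S.map_smul]
        congr 1
        ext
        exact T.map_smul c ⟨x, _⟩ }

variable [CompleteSpace H]

/-- `B` is a non-negative self-adjoint operator with `B² = A`.  A non-negative self-adjoint `A` has
exactly one such `B`. -/
structure IsNonnegSqrt (A B : H →ₗ.[ℂ] H) : Prop where
  selfAdjoint : IsSelfAdjoint B
  nonneg : ∀ x : B.domain, 0 ≤ (inner ℂ (B x) (x : H)).re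
  sq : opComp B B = A

open Classical in
/-- `A^{1/2}` for a non-negative self-adjoint operator `A` (an arbitrary value otherwise). -/
def sqrtOp (A : H →ₗ.[ℂ] H) : H →ₗ.[ℂ] H :=
  if h : ∃ B, IsNonnegSqrt A B then h.choose else ⊥

/-- `A^{-1/2}`, the inverse of the operator `A^{1/2}` (defined on the range of `A^{1/2}`, for
injective non-negative self-adjoint `A`). -/
def negHalfPow (A : H →ₗ.[ℂ] H) : H →ₗ.[ℂ] H := (sqrtOp A).inverse

end Abstract

/-- The Hodge-Dirac operator `D_𝔱 = d + d*`, with domain `D₂(d) ∩ D₂(d*)`. -/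
def diracT (n : ℕ) : L2Form n →ₗ.[ℂ] L2Form n := dOp n + dStar n

/-- The Hodge-Dirac operator `D_𝔫 = δ* + δ`, with domain `D₂(δ*) ∩ D₂(δ)`. -/
def diracN (n : ℕ) : L2Form n →ₗ.[ℂ] L2Form n := deltaStar n + deltaOp n

/-- The negative Hodge Laplacian `-Δ_{𝓗,𝔱} = D_𝔱²` with absolute boundary conditions. -/
def negLaplaceT (n : ℕ) : L2Form n →ₗ.[ℂ] L2Form n := opComp (diracT n) (diracT n)

/-- The negative Hodge Laplacian `-Δ_{𝓗,𝔫} = D_𝔫²` with relative boundary conditions. -/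
def negLaplaceN (n : ℕ) : L2Form n →ₗ.[ℂ] L2Form n := opComp (diracN n) (diracN n)

/-- The bounded operator `R` on `L²(ℝⁿ₊, Λ)` is the closure of the unbounded operator `T`: it is the
continuous extension to `L²(ℝⁿ₊, Λ)` of the densely defined operator `T`. -/
def IsBoundedClosure {n : ℕ} (T : L2Form n →ₗ.[ℂ] L2Form n) (R : L2Form n →L[ℂ] L2Form n) : Prop :=
  T.closure = (R : L2Form n →ₗ[ℂ] L2Form n).toPMap ⊤

end HodgeHalfSpace

end

open HodgeHalfSpace

noncomputable section

namespace HodgeHalfSpace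

section Abstract

set_option linter.unusedSectionVars false

open scoped ComplexInnerProductSpace

variable {H : Type*} [NormedAddCommGroup H] [InnerProductSpace ℂ H]

/-! ### Graphs of self-adjoint operators and their resolvents -/

/-! The proof separates an abstract Hodge theory from one fact about the half-space.

Abstract part (`HodgePair`): let `a` and `b` be adjoint to each other, with `a² = 0` and `ker a ∩
ker b = 0`. The orthogonal complement of the range of `a` is `ker b`. Nilpotency puts the closed
range of `a` inside `ker a`, and its complement there lies in `ker a ∩ ker b`, so the two agree and
`H = ker b ⊕ ker a` orthogonally, with projections `P` and `Q`. The Dirac operator `D = a + b` is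
self-adjoint and injective. Write `D = U|D|` with `U = sgn D`, so `U² = 1`. As `D` exchanges the two
kernels, `U P = Q U`. Hence `a|D|⁻¹ = Q U` and `b|D|⁻¹ = P U` are bounded and their product is `Q U
P U = Q = 1 - P`. Unbounded functional calculus is replaced by bounded operators: `K = (1 + D²)⁻¹`,
`W = D K`, `L = K^{1/2}`, `M = (1 - K)^{1/2}`. The graph of `|D|` is `{(Lx, Mx)}`, and `W = U (M L)`
defines `U`.

Half-space part (`IsWeakRealization.kernel_disjoint`): a form `u` with `A u = 0` and `A* u = 0`
vanishes. Since `A` is the adjoint of a first order operator on test forms, `A*` is the closure of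
that operator. Cartan's formula expresses a tangential derivative `∂_i φ` through this operator:
paired with `u`, one term vanishes because `A u = 0` and the other is controlled by the operator
applied to `φ`. Letting `φ → u` in graph norm, `⟨τ_t u, u⟩` is constant for `t ≥ 0`, where `τ_t` is
translation along the boundary. Suitable translations make a test form close to `u` orthogonal to
itself, so `u = 0`. A tangential direction exists because `n ≥ 2`.

Everything commutes with the degree projections up to a shift, which localises the result to `Λ^k`.
-/

/-- A subspace of `H × H` that is the graph of a self-adjoint operator. -/
structure IsSAGraph (G : Submodule ℂ (H × H)) : Prop where
  mem_iff : ∀ y z, (y, z) ∈ G ↔ ∀ x w, (x, w) ∈ G → ⟪w, y⟫ = ⟪x, z⟫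
  eq_zero : ∀ z, ((0 : H), z) ∈ G → z = 0

theorem isClosed_of_mem_iff {G G' : Submodule ℂ (H × H)}
    (h : ∀ y z, (y, z) ∈ G ↔ ∀ x w, (x, w) ∈ G' → ⟪w, y⟫ = ⟪x, z⟫) :
    IsClosed (G : Set (H × H)) := by
  have : (G : Set (H × H)) = ⋂ p : G', {q : H × H | ⟪p.1.2, q.1⟫ = ⟪p.1.1, q.2⟫} := by
    ext ⟨y, z⟩
    simp only [SetLike.mem_coe, h, Set.mem_iInter, Set.mem_ofPred_eq, Subtype.forall, Prod.forall]
  rw [this]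
  exact isClosed_iInter fun p => isClosed_eq (by fun_prop) (by fun_prop)

variable [CompleteSpace H]

theorem mem_graph_adjoint_iff {T : H →ₗ.[ℂ] H} (hT : Dense (T.domain : Set H)) (y z : H) :
    (y, z) ∈ T.adjoint.graph ↔ ∀ x w, (x, w) ∈ T.graph → ⟪w, y⟫ = ⟪x, z⟫ := by
  rw [LinearPMap.adjoint_graph_eq_graph_adjoint hT, Submodule.mem_adjoint_iff]
  simp only [sub_eq_zero]

theorem isSAGraph_of_isSelfAdjoint {B : H →ₗ.[ℂ] H} (hB : IsSelfAdjoint B) :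
    IsSAGraph B.graph where
  mem_iff y z := by
    rw [← mem_graph_adjoint_iff hB.dense_domain, LinearPMap.isSelfAdjoint_def.1 hB]
  eq_zero z hz := B.graph_fst_eq_zero_snd hz rfl

/-- Density of the domain is automatic: if `z` is orthogonal to it, then `(0, z)` satisfies the
adjoint relation, so it lies in the graph and `z = 0`. -/
theorem isSelfAdjoint_of_isSAGraph {B : H →ₗ.[ℂ] H} (hB : IsSAGraph B.graph) :
    IsSelfAdjoint B := by
  have hd : Dense (B.domain : Set H) := by
    rw [Submodule.dense_iff_topologicalClosure_eq_top,
      Submodule.topologicalClosure_eq_top_iff, Submodule.eq_bot_iff]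
    intro z hz
    refine hB.eq_zero z ((hB.mem_iff _ _).2 fun x w hx => ?_)
    rw [inner_zero_right, (Submodule.mem_orthogonal _ _).1 hz x
      (LinearPMap.mem_domain_of_mem_graph hx)]
  rw [LinearPMap.isSelfAdjoint_def]
  apply LinearPMap.eq_of_eq_graph
  ext ⟨y, z⟩
  rw [mem_graph_adjoint_iff hd, hB.mem_iff]

theorem dense_range_of_selfAdjoint {T : H →L[ℂ] H} (hT : IsSelfAdjoint T)
    (h : ∀ x, T x = 0 → x = 0) : DenseRange T := by
  have h1 : (LinearMap.range (T : H →ₗ[ℂ] H)).topologicalClosure = ⊤ := by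
    rw [Submodule.topologicalClosure_eq_top_iff, Submodule.eq_bot_iff]
    intro z hz
    refine h z (ext_inner_left ℂ fun v => ?_)
    rw [inner_zero_right, ← ContinuousLinearMap.adjoint_inner_left,
      ← ContinuousLinearMap.star_eq_adjoint, hT.star_eq]
    exact (Submodule.mem_orthogonal _ _).1 hz _ ⟨v, rfl⟩
  rw [← Submodule.dense_iff_topologicalClosure_eq_top] at h1
  exact h1

theorem ext_of_comp {S T J : H →L[ℂ] H} (hJ : DenseRange J) (h : S * J = T * J) : S = T := by
  have : (S : H → H) = T := hJ.equalizer S.continuous T.continuous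
    (funext fun x => congrArg (fun A : H →L[ℂ] H => A x) h)
  exact DFunLike.coe_injective this

/-- The operators `K = (1 + D²)⁻¹` and `W = D K` for a self-adjoint operator `D` with graph `G`. -/
structure IsResolventPair (G : Submodule ℂ (H × H)) (K W : H →L[ℂ] H) : Prop where
  mem₁ : ∀ h, (K h, W h) ∈ G
  mem₂ : ∀ h, (W h, h - K h) ∈ G

/-- Von Neumann's argument: project `(h, 0)` orthogonally onto the closed graph to get `(K h, W h)`.
The residual `(h - K h, -W h)` is orthogonal to the graph, which by self-adjointness says `D (W h) =
h - K h`. -/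
theorem IsSAGraph.exists_resolventPair {G : Submodule ℂ (H × H)} (hG : IsSAGraph G) :
    ∃ K W : H →L[ℂ] H, IsResolventPair G K W := by
  let e := WithLp.prodContinuousLinearEquiv 2 ℂ H H
  let G' : Submodule ℂ (WithLp 2 (H × H)) := G.comap (e : WithLp 2 (H × H) →ₗ[ℂ] H × H)
  have hcl : IsClosed (G' : Set (WithLp 2 (H × H))) :=
    (isClosed_of_mem_iff hG.mem_iff).preimage e.continuous
  have : CompleteSpace G' := hcl.completeSpace_coe
  let pr : H →L[ℂ] H × H := (e : WithLp 2 (H × H) →L[ℂ] H × H) ∘L G'.starProjection ∘L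
    (e.symm : H × H →L[ℂ] WithLp 2 (H × H)) ∘L ContinuousLinearMap.inl ℂ H H
  have hpr : ∀ h, ((pr h).1, (pr h).2) ∈ G := fun h =>
    Submodule.starProjection_apply_mem G' (e.symm (h, 0))
  refine ⟨(ContinuousLinearMap.fst ℂ H H) ∘L pr, (ContinuousLinearMap.snd ℂ H H) ∘L pr,
    fun h => hpr h, fun h => ?_⟩
  rw [hG.mem_iff]
  intro x w hx
  have h1 := Submodule.sub_starProjection_mem_orthogonal (K := G') (e.symm (h, 0))
  have h2 := (Submodule.mem_orthogonal _ _).1 h1 (e.symm (x, w)) hx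
  have h3 : ⟪x, h - (pr h).1⟫ + ⟪w, 0 - (pr h).2⟫ = 0 := h2
  rw [zero_sub, inner_neg_right] at h3
  change ⟪w, (pr h).2⟫ = ⟪x, h - (pr h).1⟫
  linear_combination -h3

namespace IsResolventPair

variable {G : Submodule ℂ (H × H)} {K W : H →L[ℂ] H}

/-- Uniqueness for `(1 + D²) x = h`: the difference `(x, w)` of two solutions satisfies `D x = w`
and `D w = -x`, so `‖w‖² = -‖x‖²`. Identities for `K` and `W` follow by exhibiting a solution. -/
theorem eq_of_mem (hG : IsSAGraph G) (hK : IsResolventPair G K W) {h x w : H}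
    (h1 : (x, w) ∈ G) (h2 : (w, h - x) ∈ G) : K h = x ∧ W h = w := by
  have e1 : (K h - x, W h - w) ∈ G := G.sub_mem (hK.mem₁ h) h1
  have e2 : (W h - w, -(K h - x)) ∈ G := by
    have := G.sub_mem (hK.mem₂ h) h2
    simpa using this
  have e3 := (hG.mem_iff _ _).1 e2 _ _ e1
  have e4 : ⟪W h - w, W h - w⟫ + ⟪K h - x, K h - x⟫ = 0 := by
    rw [e3, inner_neg_right]; ring
  rw [inner_self_eq_norm_sq_to_K, inner_self_eq_norm_sq_to_K] at e4
  have e5 : ‖W h - w‖ ^ 2 + ‖K h - x‖ ^ 2 = 0 := Complex.ofReal_eq_zero.1 (by simpa using e4)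
  have e6 : ‖W h - w‖ = 0 := by nlinarith [sq_nonneg ‖W h - w‖, sq_nonneg ‖K h - x‖]
  have e7 : ‖K h - x‖ = 0 := by nlinarith [sq_nonneg ‖W h - w‖, sq_nonneg ‖K h - x‖]
  exact ⟨sub_eq_zero.1 (norm_eq_zero.1 e7), sub_eq_zero.1 (norm_eq_zero.1 e6)⟩

theorem comm (hG : IsSAGraph G) (hK : IsResolventPair G K W) : W * K = K * W := by
  ext h
  refine ((hK.eq_of_mem hG (h := W h) (x := W (K h)) (w := K h - K (K h)) (hK.mem₂ _) ?_).1).symm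
  simpa using G.sub_mem (hK.mem₁ h) (hK.mem₁ (K h))

theorem sq_eq (hG : IsSAGraph G) (hK : IsResolventPair G K W) : W * W = K - K * K := by
  ext h
  refine (hK.eq_of_mem hG (h := W h) (x := W (K h)) (w := K h - K (K h)) (hK.mem₂ _) ?_).2
  simpa using G.sub_mem (hK.mem₁ h) (hK.mem₁ (K h))

theorem selfAdjoint_W (hG : IsSAGraph G) (hK : IsResolventPair G K W) : IsSelfAdjoint W := by
  rw [ContinuousLinearMap.isSelfAdjoint_iff_isSymmetric]
  intro h g
  have e1 := (hG.mem_iff _ _).1 (hK.mem₂ g) _ _ (hK.mem₁ h)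
  have e2 := (hG.mem_iff _ _).1 (hK.mem₁ g) _ _ (hK.mem₂ h)
  simp only [inner_sub_left, inner_sub_right] at e1 e2
  change ⟪W h, g⟫ = ⟪h, W g⟫
  have e3 := (hG.mem_iff _ _).1 (hK.mem₁ g) _ _ (hK.mem₁ h)
  have e4 := (hG.mem_iff _ _).1 (hK.mem₂ g) _ _ (hK.mem₂ h)
  simp only [inner_sub_left, inner_sub_right] at e4
  linear_combination e3 - e4

theorem nonneg_K (hG : IsSAGraph G) (hK : IsResolventPair G K W) : 0 ≤ K := by
  -- Write `g = K g + D (W g)` and move `D` to the left. The resulting form is visibly Hermitian and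
  -- non-negative.
  have key : ∀ h g, ⟪K h, g⟫ = ⟪W h, W g⟫ + ⟪K h, K g⟫ := fun h g => by
    have e1 := (hG.mem_iff _ _).1 (hK.mem₂ g) _ _ (hK.mem₁ h)
    rw [inner_sub_right] at e1
    linear_combination -e1
  rw [ContinuousLinearMap.nonneg_iff_isPositive, ContinuousLinearMap.isPositive_def]
  refine ⟨fun h g => ?_, fun h => ?_⟩
  · change ⟪K h, g⟫ = ⟪h, K g⟫
    rw [← inner_conj_symm h, key h g, key g h]
    simp
  · rw [ContinuousLinearMap.reApplyInnerSelf_apply, key, map_add]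
    exact add_nonneg inner_self_nonneg inner_self_nonneg

theorem nonneg_one_sub_K (hG : IsSAGraph G) (hK : IsResolventPair G K W) : 0 ≤ 1 - K := by
  have hs : IsSelfAdjoint (1 - K) := (IsSelfAdjoint.one _).sub (hK.nonneg_K hG).isSelfAdjoint
  rw [ContinuousLinearMap.nonneg_iff_isPositive, ContinuousLinearMap.isPositive_def']
  refine ⟨hs, fun h => ?_⟩
  have e1 := (hG.mem_iff _ _).1 (hK.mem₁ h) _ _ (hK.mem₂ h)
  have : ⟪(1 - K) h, h⟫ = ⟪W h, W h⟫ + ⟪h - K h, h - K h⟫ := by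
    change ⟪h - K h, h⟫ = _
    rw [inner_sub_right (h - K h)]
    linear_combination e1
  rw [ContinuousLinearMap.reApplyInnerSelf_apply, this, map_add]
  exact add_nonneg inner_self_nonneg inner_self_nonneg

theorem injective_K (hG : IsSAGraph G) (hK : IsResolventPair G K W) (h : H) (h0 : K h = 0) :
    h = 0 := by
  have e1 := hK.mem₁ h
  rw [h0] at e1
  have e2 := hK.mem₂ h
  rw [hG.eq_zero _ e1, h0, sub_zero] at e2
  exact hG.eq_zero _ e2

theorem injective_one_sub_K (hK : IsResolventPair G K W) (hinj : ∀ x, (x, (0 : H)) ∈ G → x = 0)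
    (h : H) (h0 : h - K h = 0) : h = 0 := by
  have e2 := hK.mem₂ h
  rw [h0] at e2
  have e1 := hK.mem₁ h
  rw [hinj _ e2] at e1
  rw [sub_eq_zero.1 h0]
  exact hinj _ e1

end IsResolventPair

/-- Square roots `L = K^{1/2}` and `M = (1 - K)^{1/2}` for a resolvent pair `K, W`. -/
structure IsRootPair (K W L M : H →L[ℂ] H) : Prop where
  nonneg_L : 0 ≤ L
  nonneg_M : 0 ≤ M
  sq_L : L * L = K
  sq_M : M * M = 1 - K
  comm : Commute L M
  comm_of : ∀ T : H →L[ℂ] H, Commute K T → Commute L T ∧ Commute M T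
  dense_L : DenseRange L
  dense_M : DenseRange M

/-- The ranges are dense because self-adjoint injective operators have dense range; for `M` this
uses injectivity of `D`, since `1 - K = D² K`. -/
theorem IsResolventPair.exists_rootPair {G : Submodule ℂ (H × H)} {K W : H →L[ℂ] H}
    (hG : IsSAGraph G) (hinj : ∀ x, (x, (0 : H)) ∈ G → x = 0) (hK : IsResolventPair G K W) :
    ∃ L M : H →L[ℂ] H, IsRootPair K W L M := by
  have h1 := hK.nonneg_K hG
  have h2 := hK.nonneg_one_sub_K hG
  have hL : CFC.sqrt K * CFC.sqrt K = K := CFC.sqrt_mul_sqrt_self K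
  have hM : CFC.sqrt (1 - K) * CFC.sqrt (1 - K) = 1 - K := CFC.sqrt_mul_sqrt_self (1 - K)
  have hc : ∀ T : H →L[ℂ] H, Commute K T → Commute (CFC.sqrt K) T ∧ Commute (CFC.sqrt (1 - K)) T :=
    fun T hT => ⟨hT.cfcₙ_nnreal _, ((Commute.one_left T).sub_left hT).cfcₙ_nnreal _⟩
  refine ⟨CFC.sqrt K, CFC.sqrt (1 - K), CFC.sqrt_nonneg _, CFC.sqrt_nonneg _, hL, hM,
    (hc _ ((hc K (Commute.refl K)).2.symm)).1, hc,
    dense_range_of_selfAdjoint (CFC.sqrt_nonneg _).isSelfAdjoint fun x hx => ?_,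
    dense_range_of_selfAdjoint (CFC.sqrt_nonneg _).isSelfAdjoint fun x hx => ?_⟩
  · refine hK.injective_K hG x ?_
    rw [← hL, mul_apply_eq_comp, hx, map_zero]
  · refine hK.injective_one_sub_K hinj x ?_
    change (1 - K) x = 0
    rw [← hM, mul_apply_eq_comp, hx, map_zero]

end Abstract

section SquareRoot

set_option linter.unusedSectionVars false

open scoped ComplexInnerProductSpace

variable {H : Type*} [NormedAddCommGroup H] [InnerProductSpace ℂ H]

/-! ### Compositions, inverses and square roots in terms of graphs -/

theorem mem_graph_opComp {S T : H →ₗ.[ℂ] H} {x z : H} :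
    (x, z) ∈ (opComp S T).graph ↔ ∃ y, (x, y) ∈ T.graph ∧ (y, z) ∈ S.graph := by
  constructor
  · intro h
    obtain ⟨x', hx, hz⟩ := (LinearPMap.mem_graph_iff _).1 h
    obtain ⟨_, y, hy, rfl⟩ := x'
    simp only at hx hz
    subst hx
    exact ⟨T y, LinearPMap.mem_graph T y, hz ▸ LinearPMap.mem_graph S ⟨T y, hy⟩⟩
  · rintro ⟨y, h1, h2⟩
    obtain ⟨x', rfl, rfl⟩ := (LinearPMap.mem_graph_iff _).1 h1
    obtain ⟨y', hy, rfl⟩ := (LinearPMap.mem_graph_iff _).1 h2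
    have hd : T x' ∈ S.domain := by have := y'.2; rwa [hy] at this
    have h3 := LinearPMap.mem_graph (opComp S T) ⟨x', ⟨x', hd, rfl⟩⟩
    have h4 : opComp S T ⟨x', ⟨x', hd, rfl⟩⟩ = S y' := by
      change S ⟨T x', hd⟩ = S y'
      congr 1
      exact Subtype.ext hy.symm
    rwa [h4] at h3

theorem mem_graph_add {S T : H →ₗ.[ℂ] H} {x z : H} :
    (x, z) ∈ (S + T).graph ↔ ∃ u v, (x, u) ∈ S.graph ∧ (x, v) ∈ T.graph ∧ u + v = z := by
  constructor
  · intro h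
    obtain ⟨x', hx, hz⟩ := (LinearPMap.mem_graph_iff _).1 h
    obtain ⟨x', h1, h2⟩ := x'
    simp only at hx hz
    subst hx
    exact ⟨S ⟨x', h1⟩, T ⟨x', h2⟩, LinearPMap.mem_graph S ⟨x', h1⟩,
      LinearPMap.mem_graph T ⟨x', h2⟩, hz⟩
  · rintro ⟨u, v, h1, h2, rfl⟩
    obtain ⟨x', rfl, rfl⟩ := (LinearPMap.mem_graph_iff _).1 h1
    obtain ⟨y', hy, rfl⟩ := (LinearPMap.mem_graph_iff _).1 h2
    have hd : (x' : H) ∈ T.domain := by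
      rw [← show (y' : H) = x' from hy]; exact y'.2
    have h3 := LinearPMap.mem_graph (S + T) ⟨x', ⟨x'.2, hd⟩⟩
    have h4 : (S + T) ⟨x', ⟨x'.2, hd⟩⟩ = S x' + T y' := by
      change S ⟨x', x'.2⟩ + T ⟨x', hd⟩ = S x' + T y'
      congr 2
      exact Subtype.ext hy.symm
    rwa [h4] at h3

theorem mem_graph_inverse {T : H →ₗ.[ℂ] H} (hT : LinearMap.ker T.toFun = ⊥) {x y : H} :
    (x, y) ∈ T.inverse.graph ↔ (y, x) ∈ T.graph := by
  rw [LinearPMap.inverse_graph hT, Submodule.mem_map]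
  constructor
  · rintro ⟨⟨u, v⟩, h, h'⟩
    cases h'
    exact h
  · exact fun h => ⟨(y, x), h, rfl⟩

theorem ker_eq_bot_iff {T : H →ₗ.[ℂ] H} :
    LinearMap.ker T.toFun = ⊥ ↔ ∀ x, (x, (0 : H)) ∈ T.graph → x = 0 := by
  rw [LinearMap.ker_eq_bot']
  constructor
  · intro h x hx
    obtain ⟨x', rfl, h0⟩ := (LinearPMap.mem_graph_iff _).1 hx
    rw [h x' h0, ZeroMemClass.coe_zero]
  · intro h x hx
    refine Subtype.ext (h x ?_)
    have := LinearPMap.mem_graph T x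
    rwa [show T x = 0 from hx] at this

/-! ### Existence and uniqueness of the square root of `D²`. -/

variable [CompleteSpace H]

/-- Heuristically `L = (1 + D²)^{-1/2}` and `M = |D| L`, so `|D|` is the relation `(L x, M x)`.
Everything rests on `L² + M² = 1` and `L M = M L`. -/
theorem IsRootPair.exists_sqrt {G : Submodule ℂ (H × H)} {K W L M : H →L[ℂ] H}
    (hG : IsSAGraph G) (hK : IsResolventPair G K W) (hR : IsRootPair K W L M) {A : H →ₗ.[ℂ] H}
    (hA : ∀ x z, (x, z) ∈ A.graph ↔ ∃ y, (x, y) ∈ G ∧ (y, z) ∈ G) :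
    ∃ B : H →ₗ.[ℂ] H, IsNonnegSqrt A B ∧ ∀ p, p ∈ B.graph ↔ ∃ x, p = (L x, M x) := by
  have hs : ∀ x, L (L x) + M (M x) = x := fun x => by
    have : (L * L + M * M) x = x := by rw [hR.sq_L, hR.sq_M, add_sub_cancel]; rfl
    exact this
  have hc : ∀ x, L (M x) = M (L x) := fun x => congrArg (fun T : H →L[ℂ] H => T x) hR.comm.eq
  have symL : ∀ x y, ⟪L x, y⟫ = ⟪x, L y⟫ :=
    (ContinuousLinearMap.isSelfAdjoint_iff_isSymmetric.1 hR.nonneg_L.isSelfAdjoint)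
  have symM : ∀ x y, ⟪M x, y⟫ = ⟪x, M y⟫ :=
    (ContinuousLinearMap.isSelfAdjoint_iff_isSymmetric.1 hR.nonneg_M.isSelfAdjoint)
  have hKL : ∀ x, K x = L (L x) := fun x =>
    congrArg (fun T : H →L[ℂ] H => T x) hR.sq_L.symm
  have hKM : ∀ x, x - K x = M (M x) := fun x =>
    congrArg (fun T : H →L[ℂ] H => T x) hR.sq_M.symm
  have injL : ∀ x, L x = 0 → x = 0 := fun x hx =>
    hK.injective_K hG x (by rw [hKL, hx, map_zero])
  let B : H →ₗ.[ℂ] H := (LinearMap.range ((L.prod M : H →L[ℂ] H × H) : H →ₗ[ℂ] H × H)).toLinearPMap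
  have hB : ∀ p, p ∈ B.graph ↔ ∃ x, p = (L x, M x) := by
    intro p
    rw [Submodule.toLinearPMap_graph_eq]
    · constructor
      · rintro ⟨x, rfl⟩; exact ⟨x, rfl⟩
      · rintro ⟨x, rfl⟩; exact ⟨x, rfl⟩
    · rintro _ ⟨x, rfl⟩ hx
      change M x = 0
      rw [injL x hx, map_zero]
  have hSA : IsSAGraph B.graph := by
    refine ⟨fun y z => ?_, fun z hz => ?_⟩
    · constructor
      · intro h x w hx
        obtain ⟨u, hu⟩ := (hB _).1 h
        obtain ⟨v, hv⟩ := (hB _).1 hx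
        cases hu; cases hv
        rw [symM, symL, hc]
      · intro h
        have h1 : M y = L z := ext_inner_left ℂ fun v => by
          rw [← symM, ← symL]; exact h _ _ ((hB _).2 ⟨v, rfl⟩)
        -- When `M y = L z`, the relation `L² + M² = 1` inverts the parametrisation: `x = L y + M z`
        -- has `L x = y` and `M x = z`.
        refine (hB _).2 ⟨L y + M z, ?_⟩
        rw [map_add, map_add, hc, ← h1, hs, ← hc, h1, hs]
    · exact B.graph_fst_eq_zero_snd hz rfl
  refine ⟨B, ⟨isSelfAdjoint_of_isSAGraph hSA, fun x => ?_, ?_⟩, hB⟩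
  · obtain ⟨u, hu⟩ := (hB _).1 (LinearPMap.mem_graph B x)
    rw [Prod.mk.injEq] at hu
    rw [hu.1, hu.2, ← inner_conj_symm, symL]
    have h1 := (ContinuousLinearMap.nonneg_iff_isPositive _).1
      (hR.comm.mul_nonneg hR.nonneg_L hR.nonneg_M)
    rw [Complex.conj_re]
    exact h1.re_inner_nonneg_right u
  · apply LinearPMap.eq_of_eq_graph
    ext ⟨x, z⟩
    rw [mem_graph_opComp, hA]
    constructor
    · rintro ⟨y, h1, h2⟩
      obtain ⟨u, hu⟩ := (hB _).1 h1
      obtain ⟨v, hv⟩ := (hB _).1 h2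
      cases hu
      rw [Prod.mk.injEq] at hv
      -- The same inversion applied to `M u = L v`; with `w = L u + M v` the pair `(x, z)` becomes
      -- `(K w, w - K w)`, and `W w` is the intermediate value.
      have e : u = L (L u + M v) := by rw [map_add, hc, ← hv.1, hs]
      have e' : v = M (L u + M v) := by rw [map_add, ← hc, hv.1, hs]
      refine ⟨W (L u + M v), ?_, ?_⟩
      · have := hK.mem₁ (L u + M v)
        rwa [hKL, ← e] at this
      · have := hK.mem₂ (L u + M v)
        rw [hKM, ← e'] at this
        rwa [hv.2]
    · rintro ⟨y, h1, h2⟩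
      have e : x + z - x = z := by abel
      have e1 : K (x + z) = x := (hK.eq_of_mem hG h1 (by rwa [e])).1
      have e2 : M (M (x + z)) = z := by rw [← hKM, e1, e]
      refine ⟨M (L (x + z)), (hB _).2 ⟨L (x + z), ?_⟩, (hB _).2 ⟨M (x + z), ?_⟩⟩
      · rw [← hKL, e1]
      · rw [hc, e2]

/-- A self-adjoint operator has no proper self-adjoint extension. -/
theorem IsSAGraph.eq_of_le {G G' : Submodule ℂ (H × H)} (hG : IsSAGraph G) (hG' : IsSAGraph G')
    (h : G ≤ G') : G = G' := by
  refine le_antisymm h fun ⟨y, z⟩ hy => (hG.mem_iff _ _).2 fun x w hx => ?_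
  exact (hG'.mem_iff _ _).1 hy x w (h hx)

/-- Every non-negative square root of `D²` has the graph `{(Lx, Mx)}`. -/
theorem IsRootPair.mem_graph_sqrt {G : Submodule ℂ (H × H)} {K W L M : H →L[ℂ] H}
    (hG : IsSAGraph G) (hK : IsResolventPair G K W) (hR : IsRootPair K W L M) {A : H →ₗ.[ℂ] H}
    (hA : ∀ x z, (x, z) ∈ A.graph ↔ ∃ y, (x, y) ∈ G ∧ (y, z) ∈ G) {B : H →ₗ.[ℂ] H}
    (hB : IsNonnegSqrt A B) (p : H × H) : p ∈ B.graph ↔ ∃ x, p = (L x, M x) := by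
  obtain ⟨B₀, hB₀, hB₀'⟩ := hR.exists_sqrt hG hK hA
  have sa := isSAGraph_of_isSelfAdjoint hB.selfAdjoint
  have sa₀ := isSAGraph_of_isSelfAdjoint hB₀.selfAdjoint
  have hcl : IsClosed (B.graph : Set (H × H)) := isClosed_of_mem_iff sa.mem_iff
  obtain ⟨K', Z, hZ⟩ := sa.exists_resolventPair
  -- `B² = D²`, so both have the same resolvent.
  have hKK : K' = K := by
    ext h
    have h1 : (K' h, h - K' h) ∈ (opComp B B).graph :=
      mem_graph_opComp.2 ⟨_, hZ.mem₁ h, hZ.mem₂ h⟩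
    rw [hB.sq, hA] at h1
    obtain ⟨y, h2, h3⟩ := h1
    exact ((hK.eq_of_mem hG h2 h3).1).symm
  subst hKK
  have hBnn : ∀ x y, (x, y) ∈ B.graph → 0 ≤ (⟪y, x⟫).re := by
    intro x y h
    obtain ⟨x', rfl, rfl⟩ := (LinearPMap.mem_graph_iff _).1 h
    exact hB.nonneg x'
  -- `Z = B K`, and splitting `h = K h + B (Z h)` gives `⟨Z h, h⟩ = ⟨B K h, K h⟩ + ⟨Z h, B Z h⟩`.
  have hZnn : 0 ≤ Z := by
    rw [ContinuousLinearMap.nonneg_iff_isPositive, ContinuousLinearMap.isPositive_def']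
    refine ⟨hZ.selfAdjoint_W sa, fun h => ?_⟩
    have e1 := hBnn _ _ (hZ.mem₁ h)
    have e2 := hBnn _ _ (hZ.mem₂ h)
    rw [← inner_conj_symm, Complex.conj_re] at e2
    have e3 : ⟪Z h, h⟫ = ⟪Z h, K' h⟫ + ⟪Z h, h - K' h⟫ := by
      rw [← inner_add_right, add_sub_cancel]
    rw [ContinuousLinearMap.reApplyInnerSelf_apply, e3]
    change 0 ≤ (_ + _ : ℂ).re
    rw [Complex.add_re]
    exact add_nonneg e1 e2
  have hML : 0 ≤ M * L := hR.comm.symm.mul_nonneg hR.nonneg_M hR.nonneg_L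
  have hsq : (M * L) * (M * L) = K' - K' * K' := by
    calc (M * L) * (M * L) = M * (L * M) * L := by simp only [mul_assoc]
      _ = (M * M) * (L * L) := by rw [hR.comm.eq]; simp only [mul_assoc]
      _ = K' - K' * K' := by rw [hR.sq_L, hR.sq_M, sub_mul, one_mul]
  -- Both are non-negative square roots of `K - K²`.
  have hZML : Z = M * L := by
    rw [← CFC.sqrt_unique (hZ.sq_eq sa) hZnn, ← CFC.sqrt_unique hsq hML]
  -- On `x = L y` the point `(L x, M x)` is `(K y, Z y)`, which lies on the graph of `B`; density of
  -- the range of `L` and closedness give the rest.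
  have hle : B₀.graph ≤ B.graph := by
    intro p hp
    obtain ⟨x, rfl⟩ := (hB₀' p).1 hp
    refine hR.dense_L.induction_on (p := fun x => (L x, M x) ∈ B.graph) x
      (hcl.preimage (L.continuous.prodMk M.continuous)) fun y => ?_
    have := hZ.mem₁ y
    rw [← hR.sq_L, hZML] at this
    exact this
  rw [← sa₀.eq_of_le sa hle, hB₀']

end SquareRoot

section HodgePair

set_option linter.unusedSectionVars false

open scoped ComplexInnerProductSpace

variable {H : Type*} [NormedAddCommGroup H] [InnerProductSpace ℂ H]

/-! ### Abstract Hodge decompositions -/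

/-- The kernel of an unbounded operator as a subspace of the ambient space. -/
def kernel (a : H →ₗ.[ℂ] H) : Submodule ℂ H := a.graph.comap (LinearMap.inl ℂ H H)

theorem mem_kernel {a : H →ₗ.[ℂ] H} {x : H} : x ∈ kernel a ↔ (x, (0 : H)) ∈ a.graph := Iff.rfl

/-- Mutually adjoint nilpotent operators without common kernel. -/
structure HodgePair (a b : H →ₗ.[ℂ] H) : Prop where
  adj_left : ∀ y z, (y, z) ∈ b.graph ↔ ∀ x w, (x, w) ∈ a.graph → ⟪w, y⟫ = ⟪x, z⟫
  adj_right : ∀ y z, (y, z) ∈ a.graph ↔ ∀ x w, (x, w) ∈ b.graph → ⟪w, y⟫ = ⟪x, z⟫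
  nilpotent : ∀ x w, (x, w) ∈ a.graph → w ∈ kernel a
  disjoint : ∀ x, x ∈ kernel a → x ∈ kernel b → x = 0

/-- The bounded operator `R` is the closure of an operator that is its restriction to a dense
range. -/
theorem closure_eq_toPMap {T : H →ₗ.[ℂ] H} {M R : H →L[ℂ] H} (hM : DenseRange M)
    (hT : ∀ x z, (x, z) ∈ T.graph ↔ ∃ h, x = M h ∧ z = R x) :
    T.closure = (R : H →ₗ[ℂ] H).toPMap ⊤ := by
  have hg : ∀ x z, (x, z) ∈ ((R : H →ₗ[ℂ] H).toPMap ⊤).graph ↔ z = R x := by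
    intro x z
    rw [LinearPMap.mem_graph_iff]
    constructor
    · rintro ⟨y, rfl, rfl⟩; rfl
    · rintro rfl; exact ⟨⟨x, trivial⟩, rfl, rfl⟩
  have hcl : IsClosed (((R : H →ₗ[ℂ] H).toPMap ⊤).graph : Set (H × H)) := by
    have : (((R : H →ₗ[ℂ] H).toPMap ⊤).graph : Set (H × H)) = {p | p.2 = R p.1} := by
      ext ⟨x, z⟩; exact hg x z
    rw [this]
    exact isClosed_eq continuous_snd (R.continuous.comp continuous_fst)
  have key : T.graph.topologicalClosure = ((R : H →ₗ[ℂ] H).toPMap ⊤).graph := by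
    refine le_antisymm (Submodule.topologicalClosure_minimal _ ?_ hcl) ?_
    · rintro ⟨x, z⟩ h
      obtain ⟨_, _, h2⟩ := (hT x z).1 h
      exact (hg x z).2 h2
    · rintro ⟨x, z⟩ h
      rw [(hg x z).1 h]
      refine hM.induction_on (p := fun x => (x, R x) ∈ T.graph.topologicalClosure) x
        (T.graph.isClosed_topologicalClosure.preimage (continuous_id.prodMk R.continuous))
        fun h => ?_
      exact Submodule.le_topologicalClosure _ ((hT _ _).2 ⟨h, rfl, rfl⟩)
  have hc : T.IsClosable := ⟨_, key⟩
  exact LinearPMap.eq_of_eq_graph (hc.graph_closure_eq_closure_graph.symm.trans key)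

namespace HodgePair

variable [CompleteSpace H] {a b : H →ₗ.[ℂ] H}

protected theorem symm (h : HodgePair a b) : HodgePair b a where
  adj_left := h.adj_right
  adj_right := h.adj_left
  nilpotent y z hy := by
    refine (h.adj_left _ _).2 fun x w hx => ?_
    change ⟪w, z⟫ = ⟪x, (0 : H)⟫
    rw [inner_zero_right, ← (h.adj_left _ _).1 hy w 0 (h.nilpotent x w hx), inner_zero_left]
  disjoint x h1 h2 := h.disjoint x h2 h1

theorem isClosed_kernel (h : HodgePair a b) : IsClosed (kernel a : Set H) :=
  (isClosed_of_mem_iff h.adj_right).preimage (continuous_id.prodMk continuous_const)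

theorem hasOrthogonalProjection (h : HodgePair a b) : (kernel a).HasOrthogonalProjection := by
  have : CompleteSpace (kernel a) := h.isClosed_kernel.completeSpace_coe
  infer_instance

theorem range_orthogonal (h : HodgePair a b) :
    (a.graph.map (LinearMap.snd ℂ H H))ᗮ = kernel b := by
  ext y
  rw [mem_kernel, h.adj_left, Submodule.mem_orthogonal]
  constructor
  · intro hy x w hx
    rw [inner_zero_right]
    exact hy w ⟨(x, w), hx, rfl⟩
  · rintro hy _ ⟨⟨x, w⟩, hx, rfl⟩
    simpa using hy x w hx

/-- Nilpotency gives one inclusion. The part of `ker a` orthogonal to the range of `a` lies in `ker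
b`, hence is zero. -/
theorem kernel_eq_closure_range (h : HodgePair a b) :
    kernel a = (a.graph.map (LinearMap.snd ℂ H H)).topologicalClosure := by
  set r := (a.graph.map (LinearMap.snd ℂ H H)).topologicalClosure with hr
  have hle : r ≤ kernel a := by
    refine Submodule.topologicalClosure_minimal _ ?_ h.isClosed_kernel
    rintro _ ⟨⟨x, w⟩, hx, rfl⟩
    exact h.nilpotent x w hx
  have : CompleteSpace r := (Submodule.isClosed_topologicalClosure _).completeSpace_coe
  have h1 := Submodule.sup_orthogonal_inf_of_hasOrthogonalProjection hle
  have h2 : rᗮ ⊓ kernel a = ⊥ := by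
    rw [hr, Submodule.orthogonal_closure, h.range_orthogonal, Submodule.eq_bot_iff]
    exact fun x hx => h.disjoint x hx.2 hx.1
  rw [h2, sup_bot_eq] at h1
  exact h1.symm

theorem kernel_orthogonal (h : HodgePair a b) : (kernel a)ᗮ = kernel b := by
  rw [h.kernel_eq_closure_range, Submodule.orthogonal_closure, h.range_orthogonal]

theorem isOrtho (h : HodgePair a b) : kernel b ⟂ kernel a := by
  rw [Submodule.isOrtho_iff_le, ← h.symm.kernel_orthogonal]
  exact Submodule.le_orthogonal_orthogonal _

/-- The orthogonal projections `P` onto the kernel of `b` and `Q` onto the kernel of `a`. -/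
structure IsProjections (a b : H →ₗ.[ℂ] H) (P Q : H →L[ℂ] H) : Prop where
  add_eq : ∀ x, P x + Q x = x
  mem_P : ∀ x, P x ∈ kernel b
  mem_Q : ∀ x, Q x ∈ kernel a
  P_of_mem : ∀ x ∈ kernel b, P x = x
  Q_of_mem : ∀ x ∈ kernel a, Q x = x
  P_zero : ∀ x ∈ kernel a, P x = 0
  Q_zero : ∀ x ∈ kernel b, Q x = 0
  adj_P : ∀ x y, ⟪P x, y⟫ = ⟪x, P y⟫

theorem exists_projections (h : HodgePair a b) : ∃ P Q : H →L[ℂ] H, IsProjections a b P Q := by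
  have := h.symm.hasOrthogonalProjection
  have hadd : ∀ x, (kernel b).starProjection x + (x - (kernel b).starProjection x) = x :=
    fun x => add_sub_cancel _ _
  have hP : ∀ x ∈ kernel b, (kernel b).starProjection x = x := fun x hx =>
    Submodule.starProjection_eq_self_iff.2 hx
  have hP0 : ∀ x ∈ kernel a, (kernel b).starProjection x = 0 := fun x hx =>
    (Submodule.starProjection_apply_eq_zero_iff _).2 (by rwa [h.symm.kernel_orthogonal])
  refine ⟨(kernel b).starProjection, 1 - (kernel b).starProjection, hadd,
    fun x => Submodule.starProjection_apply_mem _ x, fun x => ?_, hP, fun x hx => ?_, hP0,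
    fun x hx => ?_, fun x y => Submodule.inner_starProjection_left_eq_right _ x y⟩
  · rw [← h.symm.kernel_orthogonal]
    exact Submodule.sub_starProjection_mem_orthogonal x
  · change x - (kernel b).starProjection x = x
    rw [hP0 x hx, sub_zero]
  · change x - (kernel b).starProjection x = 0
    rw [hP x hx, sub_self]

theorem IsProjections.symm {P Q : H →L[ℂ] H} (hP : IsProjections a b P Q) :
    IsProjections b a Q P where
  add_eq x := by rw [add_comm, hP.add_eq]
  mem_P := hP.mem_Q
  mem_Q := hP.mem_P
  P_of_mem := hP.Q_of_mem
  Q_of_mem := hP.P_of_mem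
  P_zero := hP.Q_zero
  Q_zero := hP.P_zero
  adj_P x y := by
    have e : ∀ x, Q x = x - P x := fun x => eq_sub_of_add_eq' (hP.add_eq x)
    rw [e, e, inner_sub_left, inner_sub_right, hP.adj_P]

/-! ### The Dirac operator `a + b` and its phase. -/

variable {P Q : H →L[ℂ] H}

/-- `x` and `P x` differ by `Q x`, which `a` annihilates. -/
theorem P_mem (hP : IsProjections a b P Q) {x w : H} (hx : (x, w) ∈ a.graph) :
    (P x, w) ∈ a.graph := by
  have := a.graph.sub_mem hx (mem_kernel.1 (hP.mem_Q x))
  rw [Prod.mk_sub_mk, sub_zero] at this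
  rwa [eq_sub_of_add_eq (hP.add_eq x)]

/-- For maximality, let `(y, z)` satisfy the adjoint relation. Testing it with `Q x` for `x ∈ D(b)`,
where `a + b` takes the value `b x`, yields `a y = Q z`; testing with `P x` for `x ∈ D(a)` yields `b
y = P z`. -/
theorem isSAGraph (h : HodgePair a b) : IsSAGraph (a + b).graph := by
  obtain ⟨P, Q, hP⟩ := h.exists_projections
  refine ⟨fun y z => ⟨fun hy x w hx => ?_, fun hy => ?_⟩,
    fun z hz => (a + b).graph_fst_eq_zero_snd hz rfl⟩
  · obtain ⟨u, v, h1, h2, rfl⟩ := mem_graph_add.1 hx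
    obtain ⟨u', v', h1', h2', rfl⟩ := mem_graph_add.1 hy
    rw [inner_add_left, inner_add_right, (h.adj_left _ _).1 h2' _ _ h1,
      (h.adj_right _ _).1 h1' _ _ h2, add_comm]
  · refine mem_graph_add.2 ⟨Q z, P z, ?_, ?_, by rw [add_comm]; exact hP.add_eq z⟩
    · refine (h.adj_right _ _).2 fun x w hx => ?_
      rw [← hP.symm.adj_P]
      refine hy _ _ (mem_graph_add.2 ⟨0, w, mem_kernel.1 (hP.mem_Q x), P_mem hP.symm hx, zero_add w⟩)
    · refine (h.adj_left _ _).2 fun x w hx => ?_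
      rw [← hP.adj_P]
      refine hy _ _ (mem_graph_add.2 ⟨w, 0, P_mem hP hx, mem_kernel.1 (hP.mem_P x), add_zero w⟩)

theorem mem_graph_add_iff (h : HodgePair a b) (hP : IsProjections a b P Q) {x w : H} :
    (x, w) ∈ (a + b).graph ↔ (x, Q w) ∈ a.graph ∧ (x, P w) ∈ b.graph := by
  rw [mem_graph_add]
  constructor
  · rintro ⟨u, v, h1, h2, rfl⟩
    have hu := h.nilpotent _ _ h1
    have hv := h.symm.nilpotent _ _ h2
    rw [map_add, map_add, hP.Q_of_mem u hu, hP.Q_zero v hv, hP.P_of_mem v hv, hP.P_zero u hu,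
      add_zero, zero_add]
    exact ⟨h1, h2⟩
  · rintro ⟨h1, h2⟩
    exact ⟨_, _, h1, h2, by rw [add_comm]; exact hP.add_eq w⟩

theorem dirac_injective (h : HodgePair a b) (x : H) (hx : (x, (0 : H)) ∈ (a + b).graph) :
    x = 0 := by
  obtain ⟨P, Q, hP⟩ := h.exists_projections
  obtain ⟨h1, h2⟩ := (h.mem_graph_add_iff hP).1 hx
  rw [map_zero] at h1 h2
  exact h.disjoint x h1 h2

theorem dirac_intertwine (h : HodgePair a b) (hP : IsProjections a b P Q) {x w : H}
    (hx : (x, w) ∈ (a + b).graph) : (P x, Q w) ∈ (a + b).graph := by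
  obtain ⟨h1, _⟩ := (h.mem_graph_add_iff hP).1 hx
  exact mem_graph_add.2 ⟨Q w, 0, P_mem hP h1, mem_kernel.1 (hP.mem_P x), add_zero _⟩

theorem exists_nonnegSqrt (h : HodgePair a b) : ∃ B, IsNonnegSqrt (opComp (a + b) (a + b)) B := by
  obtain ⟨K, W, hK⟩ := h.isSAGraph.exists_resolventPair
  obtain ⟨L, M, hR⟩ := hK.exists_rootPair h.isSAGraph h.dirac_injective
  obtain ⟨B, hB, _⟩ := hR.exists_sqrt h.isSAGraph hK fun x z => mem_graph_opComp
  exact ⟨B, hB⟩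

/-- `U` is the sign of `D`. Since `W` and `M L` are self-adjoint with the same square, `‖W x‖ = ‖M L
x‖`, so `M L x ↦ W x` extends continuously from a dense range. The identities for `U` are checked
after composing with `M L`. -/
theorem exists_phase (h : HodgePair a b) (hP : IsProjections a b P Q) {K W L M : H →L[ℂ] H}
    (hK : IsResolventPair (a + b).graph K W) (hR : IsRootPair K W L M) :
    ∃ U : H →L[ℂ] H, (∀ x, (L x, U (M x)) ∈ (a + b).graph) ∧ U * U = 1 ∧ U * P = Q * U := by
  have hG := h.isSAGraph
  have hcW := hR.comm_of W (hK.comm hG).symm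
  have hML : (M * L) * (M * L) = K - K * K := by
    calc (M * L) * (M * L) = M * (L * M) * L := by simp only [mul_assoc]
      _ = (M * M) * (L * L) := by rw [hR.comm.eq]; simp only [mul_assoc]
      _ = K - K * K := by rw [hR.sq_L, hR.sq_M, sub_mul, one_mul]
  have hMLsa : IsSelfAdjoint (M * L) :=
    (hR.comm.symm.mul_nonneg hR.nonneg_M hR.nonneg_L).isSelfAdjoint
  have hd : DenseRange (M * L : H →L[ℂ] H) := hR.dense_M.comp hR.dense_L M.continuous
  have hnorm : ∀ x, ‖W x‖ = ‖(M * L) x‖ := by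
    have key : ∀ T : H →L[ℂ] H, IsSelfAdjoint T → ∀ x, (‖T x‖ : ℂ) ^ 2 = ⟪x, (T * T) x⟫ := by
      intro T hT x
      have e := ContinuousLinearMap.isSelfAdjoint_iff_isSymmetric.1 hT x (T x)
      exact (inner_self_eq_norm_sq_to_K (𝕜 := ℂ) (T x)).symm.trans e
    intro x
    have e := key W (hK.selfAdjoint_W hG) x
    rw [hK.sq_eq hG, ← hML, ← key _ hMLsa x] at e
    have e' : ‖W x‖ ^ 2 = ‖(M * L) x‖ ^ 2 := by exact_mod_cast e
    exact (sq_eq_sq₀ (norm_nonneg _) (norm_nonneg _)).1 e'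
  obtain ⟨U, hU⟩ : ∃ U : H →L[ℂ] H, U * (M * L) = W :=
    ⟨(W : H →ₗ[ℂ] H).extendOfNorm ((M * L : H →L[ℂ] H) : H →ₗ[ℂ] H), by
      ext x
      exact LinearMap.extendOfNorm_eq hd ⟨1, fun x => by rw [one_mul]; exact (hnorm x).le⟩ x⟩
  have hWML : W * (M * L) = (M * L) * W := by
    rw [← mul_assoc, ← hcW.2.eq, mul_assoc, ← hcW.1.eq, mul_assoc]
  have hUW : U * W = W * U := by
    refine ext_of_comp hd ?_
    rw [mul_assoc, hWML, ← mul_assoc, hU, mul_assoc, hU]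
  refine ⟨U, fun x => ?_, ?_, ?_⟩
  · refine hR.dense_L.induction_on (p := fun x => (L x, U (M x)) ∈ (a + b).graph) x
      ((isClosed_of_mem_iff hG.mem_iff).preimage
        (L.continuous.prodMk (U.continuous.comp M.continuous))) fun y => ?_
    have e1 : U (M (L y)) = W y := congrArg (fun T : H →L[ℂ] H => T y) hU
    have e2 : L (L y) = K y := congrArg (fun T : H →L[ℂ] H => T y) hR.sq_L
    rw [e1, e2]
    exact hK.mem₁ y
  -- `U` commutes with `W`, so `U² (M L)² = U W (M L) = W U (M L) = W² = (M L)²`.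
  · refine ext_of_comp hd (ext_of_comp hd ?_)
    rw [mul_assoc U U, hU, hUW, mul_assoc, hU, hK.sq_eq hG, one_mul, hML]
  -- `D P = Q D` and `D Q = P D`, so `P` commutes with `D²`, hence with `K`, `L` and `M`, while `W P
  -- = Q W`.
  · have hPK : ∀ x, K (P x) = P (K x) ∧ W (P x) = Q (W x) := fun x => by
      refine hK.eq_of_mem hG (h.dirac_intertwine hP (hK.mem₁ x)) ?_
      have e1 := hK.mem₂ x
      obtain ⟨_, h2⟩ := (h.mem_graph_add_iff hP).1 e1
      rw [map_sub] at h2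
      exact mem_graph_add.2 ⟨0, _, mem_kernel.1 (hP.mem_Q _), P_mem hP.symm h2, zero_add _⟩
    have hcP := hR.comm_of P (ContinuousLinearMap.ext fun x => (hPK x).1)
    have hWP : W * P = Q * W := ContinuousLinearMap.ext fun x => (hPK x).2
    refine ext_of_comp hd ?_
    rw [mul_assoc, ← mul_assoc P, ← hcP.2.eq, mul_assoc M, ← hcP.1.eq, ← mul_assoc M, ← mul_assoc,
      hU, hWP, mul_assoc Q, hU]

/-- The Riesz transforms `a (D²)^{-1/2}` and `b (D²)^{-1/2}` of a Hodge pair. -/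
theorem exists_riesz (h : HodgePair a b) {B : H →ₗ.[ℂ] H}
    (hB : IsNonnegSqrt (opComp (a + b) (a + b)) B) :
    LinearMap.ker B.toFun = ⊥ ∧ ∃ R S : H →L[ℂ] H,
      (opComp a B.inverse).closure = (R : H →ₗ[ℂ] H).toPMap ⊤ ∧
      (opComp b B.inverse).closure = (S : H →ₗ[ℂ] H).toPMap ⊤ ∧
      ∀ f, f - R (S f) ∈ kernel b ∧ R (S f) ∈ kernel a := by
  obtain ⟨P, Q, hP⟩ := h.exists_projections
  obtain ⟨K, W, hK⟩ := h.isSAGraph.exists_resolventPair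
  obtain ⟨L, M, hR⟩ := hK.exists_rootPair h.isSAGraph h.dirac_injective
  have hBg := hR.mem_graph_sqrt h.isSAGraph hK (fun x z => mem_graph_opComp) hB
  obtain ⟨U, hU, hUU, hUP⟩ := h.exists_phase hP hK hR
  have hker : LinearMap.ker B.toFun = ⊥ := by
    rw [ker_eq_bot_iff]
    intro x hx
    obtain ⟨u, hu⟩ := (hBg _).1 hx
    rw [Prod.mk.injEq] at hu
    have : u = 0 := by
      refine hK.injective_one_sub_K h.dirac_injective u ?_
      change (1 - K) u = 0
      rw [← hR.sq_M, mul_apply_eq_comp, ← hu.2, map_zero]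
    rw [hu.1, this, map_zero]
  -- From `D (L x) = U (M x)`, the `a` and `b` components are cut out by `Q` and `P`.
  have hL : ∀ x, (L x, (Q * U) (M x)) ∈ a.graph ∧ (L x, (P * U) (M x)) ∈ b.graph := fun x =>
    (h.mem_graph_add_iff hP).1 (hU x)
  have hinv : ∀ x y, (x, y) ∈ B.inverse.graph ↔ ∃ u, x = M u ∧ y = L u := fun x y => by
    rw [mem_graph_inverse hker, hBg]
    simp only [Prod.mk.injEq, and_comm]
  have hcomp : ∀ (c : H →ₗ.[ℂ] H) (R : H →L[ℂ] H), (∀ x, (L x, R (M x)) ∈ c.graph) →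
      (opComp c B.inverse).closure = (R : H →ₗ[ℂ] H).toPMap ⊤ := by
    intro c R hc
    refine closure_eq_toPMap hR.dense_M fun x z => ?_
    rw [mem_graph_opComp]
    constructor
    · rintro ⟨y, h1, h2⟩
      obtain ⟨u, rfl, rfl⟩ := (hinv _ _).1 h1
      exact ⟨u, rfl, c.mem_graph_snd_inj h2 (hc u) rfl⟩
    · rintro ⟨u, rfl, rfl⟩
      exact ⟨L u, (hinv _ _).2 ⟨u, rfl, rfl⟩, hc u⟩
  refine ⟨hker, Q * U, P * U, hcomp _ _ fun x => (hL x).1, hcomp _ _ fun x => (hL x).2,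
    fun f => ?_⟩
  have e1 : (Q * U) ((P * U) f) = Q f := by
    have e2 : (Q * U) * (P * U) = Q * Q := by
      rw [mul_assoc, ← mul_assoc U, hUP, mul_assoc Q, hUU, mul_one]
    have e3 : (Q * U) ((P * U) f) = Q (Q f) := congrArg (fun T : H →L[ℂ] H => T f) e2
    rw [e3, hP.Q_of_mem _ (hP.mem_Q f)]
  rw [e1]
  refine ⟨?_, hP.mem_Q f⟩
  rw [← eq_sub_of_add_eq (hP.add_eq f)]
  exact hP.mem_P f

end HodgePair

end HodgePair

/-! ### The grading by degree -/

/-- The projection of `Λ` onto `Λ^k`. -/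
def degProj (n : ℕ) (k : ℤ) : Form n →L[ℂ] Form n :=
  LinearMap.toContinuousLinearMap
    { toFun := fun u => WithLp.toLp 2 fun I => if (I.card : ℤ) = k then u I else 0
      map_add' := fun u v => by ext J; by_cases h : (J.card : ℤ) = k <;> simp [h]
      map_smul' := fun c u => by ext J; by_cases h : (J.card : ℤ) = k <;> simp [h] }

theorem degProj_apply {n : ℕ} (k : ℤ) (u : Form n) (I : Finset (Fin n)) :
    degProj n k u I = if (I.card : ℤ) = k then u I else 0 := rfl

theorem inner_degProj {n : ℕ} (k : ℤ) (u v : Form n) :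
    inner ℂ (degProj n k u) v = inner ℂ u (degProj n k v) := by
  simp only [PiLp.inner_apply, degProj_apply]
  refine Finset.sum_congr rfl fun I _ => ?_
  by_cases h : (I.card : ℤ) = k <;> simp [h]

/-- The projection of `L²(ℝⁿ₊, Λ)` onto `L²(ℝⁿ₊, Λ^k)`. -/
def l2Proj (n : ℕ) (k : ℤ) : L2Form n →L[ℂ] L2Form n := (degProj n k).compLpL 2 (hMeasure n)

theorem coeFn_l2Proj {n : ℕ} (k : ℤ) (u : L2Form n) :
    ∀ᵐ x ∂(hMeasure n), l2Proj n k u x = degProj n k (u x) :=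
  (degProj n k).coeFn_compLpL u

theorem inner_l2Proj {n : ℕ} (k : ℤ) (u v : L2Form n) :
    inner ℂ (l2Proj n k u) v = inner ℂ u (l2Proj n k v) := by
  rw [L2.inner_def, L2.inner_def]
  refine integral_congr_ae ?_
  filter_upwards [coeFn_l2Proj k u, coeFn_l2Proj k v] with x h1 h2
  rw [h1, h2, inner_degProj]

theorem mem_L2Deg_iff {n : ℕ} {k : ℤ} {u : L2Form n} : u ∈ L2Deg n k ↔ l2Proj n k u = u := by
  constructor
  · intro h
    refine Lp.ext ?_
    have h' : ∀ I : Finset (Fin n), ∀ᵐ x ∂(hMeasure n), (I.card : ℤ) ≠ k → u x I = 0 := fun I => by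
      by_cases hI : (I.card : ℤ) = k
      · exact Filter.Eventually.of_forall fun x h => absurd hI h
      · filter_upwards [h I hI] with x hx _ using hx
    filter_upwards [coeFn_l2Proj k u, ae_all_iff.2 h'] with x h1 h2
    rw [h1]
    ext I
    rw [degProj_apply]
    split_ifs with hI
    · rfl
    · exact (h2 I hI).symm
  · intro h I hI
    filter_upwards [coeFn_l2Proj k u] with x h1
    rw [h] at h1
    rw [h1, degProj_apply, if_neg hI]

theorem l2Proj_mem {n : ℕ} (k : ℤ) (u : L2Form n) : l2Proj n k u ∈ L2Deg n k := by
  intro I hI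
  filter_upwards [coeFn_l2Proj k u] with x h1
  rw [h1, degProj_apply, if_neg hI]

theorem isClosed_L2Deg (n : ℕ) (k : ℤ) : IsClosed (L2Deg n k : Set (L2Form n)) := by
  have : (L2Deg n k : Set (L2Form n)) = {u | l2Proj n k u = u} := by
    ext u; exact mem_L2Deg_iff
  rw [this]
  exact isClosed_eq (l2Proj n k).continuous continuous_id

/-- The operator `A` maps forms of degree `j` to forms of degree `k`, compatibly with the
projections. -/
def MapsDegree {n : ℕ} (A : L2Form n →ₗ.[ℂ] L2Form n) (j k : ℤ) : Prop :=
  ∀ x w, (x, w) ∈ A.graph → (l2Proj n j x, l2Proj n k w) ∈ A.graph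

theorem MapsDegree.adjoint {n : ℕ} {a b : L2Form n →ₗ.[ℂ] L2Form n} (h : HodgePair a b) {j k : ℤ}
    (ha : MapsDegree a j k) : MapsDegree b k j := by
  intro y z hy
  refine (h.adj_left _ _).2 fun x w hx => ?_
  rw [← inner_l2Proj, ← inner_l2Proj]
  exact (h.adj_left _ _).1 hy _ _ (ha x w hx)

theorem nullForms_eq {n : ℕ} (A : L2Form n →ₗ.[ℂ] L2Form n) (k : ℤ) :
    nullForms A k = kernel A ⊓ L2Deg n k := by
  rw [nullForms]
  congr 1
  ext x
  rw [mem_kernel, Submodule.mem_map, LinearPMap.mem_graph_iff]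
  constructor
  · rintro ⟨y, h, rfl⟩; exact ⟨y, rfl, h⟩
  · rintro ⟨y, rfl, h⟩; exact ⟨y, h, rfl⟩

theorem mem_imageForms {n : ℕ} {A : L2Form n →ₗ.[ℂ] L2Form n} {j : ℤ} {w : L2Form n} :
    w ∈ imageForms A j ↔ ∃ x ∈ L2Deg n j, (x, w) ∈ A.graph := by
  rw [imageForms, Submodule.mem_map]
  constructor
  · rintro ⟨y, h, rfl⟩; exact ⟨y, h, LinearPMap.mem_graph A y⟩
  · rintro ⟨x, h, hx⟩
    obtain ⟨y, rfl, rfl⟩ := (LinearPMap.mem_graph_iff _).1 hx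
    exact ⟨y, h, rfl⟩

theorem MapsDegree.mem_kernel {n : ℕ} {A : L2Form n →ₗ.[ℂ] L2Form n} {j k : ℤ}
    (hA : MapsDegree A j k) {x : L2Form n} (hx : x ∈ kernel A) : l2Proj n j x ∈ kernel A := by
  have h := hA x 0 hx
  rwa [map_zero] at h

/-- Approximate a closed form of degree `k` by elements `a x`; its degree `k` part is `a` applied to
the degree `j` part of `x`, and still converges. -/
theorem nullForms_eq_closure {n : ℕ} {a b : L2Form n →ₗ.[ℂ] L2Form n} (h : HodgePair a b)
    {j k : ℤ} (ha : MapsDegree a j k) :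
    nullForms a k = (imageForms a j).topologicalClosure := by
  rw [nullForms_eq]
  apply le_antisymm
  · rintro u ⟨hu, hk⟩
    rw [h.kernel_eq_closure_range] at hu
    rw [← mem_L2Deg_iff.1 hk]
    refine map_mem_closure (l2Proj n k).continuous hu ?_
    rintro _ ⟨⟨x, w⟩, hx, rfl⟩
    exact mem_imageForms.2 ⟨_, l2Proj_mem j x, ha x w hx⟩
  · refine Submodule.topologicalClosure_minimal _ ?_
      (h.isClosed_kernel.inter (isClosed_L2Deg n k))
    intro w hw
    obtain ⟨x, hx, hxw⟩ := mem_imageForms.1 hw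
    refine ⟨h.nilpotent x w hxw, ?_⟩
    have h1 := ha x w hxw
    rw [mem_L2Deg_iff.1 hx] at h1
    rw [← a.mem_graph_snd_inj h1 hxw rfl]
    exact l2Proj_mem k w

theorem HodgePair.decomposition {n : ℕ} {a b : L2Form n →ₗ.[ℂ] L2Form n} (h : HodgePair a b)
    (ha : ∀ k, MapsDegree a k (k + 1)) (k : ℤ) :
    nullForms a k = (imageForms a (k - 1)).topologicalClosure ∧
      nullForms b k = (imageForms b (k + 1)).topologicalClosure ∧
      IsNonnegSqrt (opComp (a + b) (a + b)) (sqrtOp (opComp (a + b) (a + b))) ∧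
      LinearMap.ker (sqrtOp (opComp (a + b) (a + b))).toFun = ⊥ ∧
      (∃ (_ : (nullForms b k).HasOrthogonalProjection) (R S : L2Form n →L[ℂ] L2Form n),
        IsBoundedClosure (opComp a (negHalfPow (opComp (a + b) (a + b)))) R ∧
        IsBoundedClosure (opComp b (negHalfPow (opComp (a + b) (a + b)))) S ∧
        ∀ f ∈ L2Deg n k, (nullForms b k).starProjection f = f - R (S f)) ∧
      nullForms b k ⟂ nullForms a k ∧
      nullForms b k ⊔ nullForms a k = L2Deg n k := by
  have hb : ∀ k, MapsDegree b (k + 1) k := fun k => (ha k).adjoint h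
  have ha' : MapsDegree a (k - 1) k := by simpa using ha (k - 1)
  have hb' : MapsDegree b k (k - 1) := by simpa using hb (k - 1)
  have hB : IsNonnegSqrt (opComp (a + b) (a + b)) (sqrtOp (opComp (a + b) (a + b))) := by
    rw [sqrtOp, dif_pos h.exists_nonnegSqrt]
    exact h.exists_nonnegSqrt.choose_spec
  obtain ⟨hker, R, S, hR, hS, hRS⟩ := h.exists_riesz hB
  have hN : IsClosed (nullForms b k : Set (L2Form n)) := by
    rw [nullForms_eq]
    exact h.symm.isClosed_kernel.inter (isClosed_L2Deg n k)
  have hP : (nullForms b k).HasOrthogonalProjection := by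
    have : CompleteSpace (nullForms b k) := hN.completeSpace_coe
    infer_instance
  have hortho : nullForms b k ⟂ nullForms a k := by
    rw [nullForms_eq, nullForms_eq]
    exact h.isOrtho.mono inf_le_left inf_le_left
  -- the components of a form of degree `k` have degree `k`
  have hdeg : ∀ f ∈ L2Deg n k, f - R (S f) ∈ nullForms b k ∧ R (S f) ∈ nullForms a k := by
    intro f hf
    obtain ⟨h1, h2⟩ := hRS f
    -- The off-degree parts of the two components cancel. One lies in `ker b`, the other in `ker a`,
    -- so both vanish.
    have e : (f - R (S f)) - l2Proj n k (f - R (S f)) = l2Proj n k (R (S f)) - R (S f) := by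
      rw [map_sub, mem_L2Deg_iff.1 hf]; abel
    have e1 : (f - R (S f)) - l2Proj n k (f - R (S f)) ∈ kernel b :=
      Submodule.sub_mem _ h1 (hb'.mem_kernel h1)
    have e2 : l2Proj n k (R (S f)) - R (S f) ∈ kernel a :=
      Submodule.sub_mem _ ((ha k).mem_kernel h2) h2
    have e3 := h.disjoint _ e2 (e ▸ e1)
    have e4 : R (S f) ∈ L2Deg n k := mem_L2Deg_iff.2 (sub_eq_zero.1 e3)
    rw [nullForms_eq, nullForms_eq]
    exact ⟨⟨h1, Submodule.sub_mem _ hf e4⟩, ⟨h2, e4⟩⟩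
  refine ⟨nullForms_eq_closure h ha', nullForms_eq_closure h.symm (hb k), hB, hker,
    ⟨hP, R, S, hR, hS, fun f hf => ?_⟩, hortho, le_antisymm ?_ fun f hf => ?_⟩
  · refine Submodule.eq_starProjection_of_mem_of_inner_eq_zero (hdeg f hf).1 fun w hw => ?_
    rw [sub_sub_cancel]
    exact inner_eq_zero_symm.1 (hortho.inner_eq hw (hdeg f hf).2)
  · rw [nullForms_eq, nullForms_eq]
    exact sup_le inf_le_right inf_le_right
  · rw [← sub_add_cancel f (R (S f))]
    exact Submodule.add_mem_sup (hdeg f hf).1 (hdeg f hf).2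

/-! ### The canonical anticommutation relations -/

section Algebra

variable {n : ℕ}

theorem contract_apply (j : Fin n) (u : Form n) (I : Finset (Fin n)) :
    contract j u I = if j ∈ I then 0 else sgn j I * u (insert j I) := rfl

theorem wedge_apply (j : Fin n) (u : Form n) (I : Finset (Fin n)) :
    wedge j u I = if j ∈ I then sgn j (I.erase j) * u (I.erase j) else 0 := rfl

theorem sgn_mul_self (j : Fin n) (I : Finset (Fin n)) : sgn j I * sgn j I = 1 := by
  rw [sgn, ← mul_pow]; norm_num

theorem sgn_insert {i j : Fin n} {I : Finset (Fin n)} (hi : i ∉ I) :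
    sgn j (insert i I) = (if i < j then -1 else 1) * sgn j I := by
  rw [sgn, sgn, Finset.filter_insert]
  split_ifs with h
  · rw [Finset.card_insert_of_notMem (by simp [hi]), pow_succ, mul_comm]
  · rw [one_mul]

theorem sgn_mul_sgn_insert {i j : Fin n} (hij : i ≠ j) {I : Finset (Fin n)} (hi : i ∉ I)
    (hj : j ∉ I) : sgn i I * sgn j (insert i I) = -(sgn j I * sgn i (insert j I)) := by
  rw [sgn_insert hi, sgn_insert hj]
  rcases lt_or_gt_of_ne hij with h | h
  · rw [if_pos h, if_neg (not_lt.2 h.le)]; ring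
  · rw [if_pos h, if_neg (not_lt.2 h.le)]; ring

theorem contract_contract (i j : Fin n) (u : Form n) :
    contract i (contract j u) = -contract j (contract i u) := by
  ext I
  rw [PiLp.neg_apply, contract_apply, contract_apply, contract_apply, contract_apply]
  by_cases hij : i = j
  · subst hij; simp
  by_cases hi : i ∈ I
  · simp [hi]
  by_cases hj : j ∈ I
  · simp [hj]
  rw [if_neg hi, if_neg hj, if_neg (by simp [hj, Ne.symm hij]), if_neg (by simp [hi, hij]),
    Finset.insert_comm j i, ← mul_assoc, ← mul_assoc, sgn_mul_sgn_insert hij hi hj, neg_mul]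

theorem wedge_wedge (i j : Fin n) (u : Form n) :
    wedge i (wedge j u) = -wedge j (wedge i u) := by
  refine ext_inner_right ℂ fun v => ?_
  rw [inner_neg_left, inner_wedge_left, inner_wedge_left, inner_wedge_left, inner_wedge_left,
    contract_contract, inner_neg_right]

theorem contract_wedge (i j : Fin n) (u : Form n) :
    contract i (wedge j u) + wedge j (contract i u) = if i = j then u else 0 := by
  ext I
  rw [PiLp.add_apply, contract_apply, wedge_apply, wedge_apply, contract_apply]
  by_cases hij : i = j
  · subst hij
    by_cases hi : i ∈ I
    · simp [hi, ← mul_assoc, sgn_mul_self]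
    · simp [hi, ← mul_assoc, sgn_mul_self]
  rw [if_neg hij, PiLp.zero_apply]
  by_cases hi : i ∈ I
  · simp [hi, hij]
  by_cases hj : j ∈ I
  · obtain ⟨I, hjI, rfl⟩ : ∃ I', j ∉ I' ∧ insert j I' = I :=
      ⟨I.erase j, Finset.notMem_erase j I, Finset.insert_erase hj⟩
    have hi' : i ∉ I := fun h => hi (Finset.mem_insert_of_mem h)
    rw [if_neg hi, if_pos (by simp), if_pos hj, Finset.erase_insert hjI, if_neg hi',
      Finset.insert_comm i j, Finset.erase_insert (by simp [hjI, Ne.symm hij]), ← mul_assoc,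
      ← mul_assoc, ← add_mul]
    have e := sgn_mul_sgn_insert hij hi' hjI
    rw [sgn_insert hi'] at e ⊢
    rw [sgn_insert hjI] at e ⊢
    rcases lt_or_gt_of_ne hij with h | h
    · rw [if_pos h, if_neg (not_lt.2 h.le)]; ring
    · rw [if_pos h, if_neg (not_lt.2 h.le)]; ring
  · simp [hi, hj, Ne.symm hij]

theorem degProj_contract (j : Fin n) (k : ℤ) (u : Form n) :
    contract j (degProj n (k + 1) u) = degProj n k (contract j u) := by
  ext I
  rw [degProj_apply, contract_apply, contract_apply, degProj_apply]
  by_cases hj : j ∈ I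
  · simp [hj]
  · simp [hj]

theorem degProj_wedge (j : Fin n) (k : ℤ) (u : Form n) :
    wedge j (degProj n k u) = degProj n (k + 1) (wedge j u) := by
  refine ext_inner_right ℂ fun v => ?_
  rw [inner_wedge_left, inner_degProj, inner_degProj, inner_wedge_left, degProj_contract]

end Algebra

/-! ### First order operators on test forms -/

section FirstOrder

variable {n : ℕ}

/-- The first order differential operator `φ ↦ ∑_j c_j ∂_j φ`. -/
def firstOrder (c : Fin n → Form n →L[ℂ] Form n) (φ : EuclideanSpace ℝ (Fin n) → Form n)
    (x : EuclideanSpace ℝ (Fin n)) : Form n :=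
  ∑ j, c j (fderiv ℝ φ x (EuclideanSpace.single j 1))

variable {c : Fin n → Form n →L[ℂ] Form n} {φ ψ : EuclideanSpace ℝ (Fin n) → Form n}

theorem IsTestForm.differentiable (h : IsTestForm φ) : Differentiable ℝ φ :=
  h.smooth.differentiable (by simp)

theorem IsTestForm.add (h : IsTestForm φ) (h' : IsTestForm ψ) :
    IsTestForm (fun x => φ x + ψ x) where
  smooth := h.smooth.add h'.smooth
  compact := h.compact.add h'.compact
  support := (tsupport_add φ ψ).trans (Set.union_subset h.support h'.support)

theorem IsTestForm.clm_comp (h : IsTestForm φ) (A : Form n →L[ℂ] Form n) :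
    IsTestForm (fun x => A (φ x)) where
  smooth := (A.restrictScalars ℝ).contDiff.comp h.smooth
  compact := h.compact.comp_left (map_zero A)
  support := (tsupport_comp_subset (map_zero A) φ).trans h.support

theorem isTestForm_zero : IsTestForm (fun _ : EuclideanSpace ℝ (Fin n) => (0 : Form n)) where
  smooth := contDiff_const
  compact := HasCompactSupport.zero
  support := by simp [tsupport]

theorem isTestForm_sum {ι : Type*} (s : Finset ι) {f : ι → EuclideanSpace ℝ (Fin n) → Form n}
    (h : ∀ i, IsTestForm (f i)) : IsTestForm (fun x => ∑ i ∈ s, f i x) := by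
  classical
  induction s using Finset.induction_on with
  | empty => simpa using isTestForm_zero
  | insert i s hi ih => simpa [Finset.sum_insert hi] using (h i).add ih

theorem IsTestForm.fderiv_apply (h : IsTestForm φ) (v : EuclideanSpace ℝ (Fin n)) :
    IsTestForm (fun x => fderiv ℝ φ x v) where
  smooth := (h.smooth.fderiv_right (m := ∞) (by simp)).clm_apply contDiff_const
  compact := h.compact.fderiv_apply ℝ v
  support := (tsupport_fderiv_apply_subset ℝ v).trans h.support

theorem isTestForm_firstOrder (h : IsTestForm φ) (c : Fin n → Form n →L[ℂ] Form n) :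
    IsTestForm (firstOrder c φ) :=
  isTestForm_sum _ fun j => (h.fderiv_apply _).clm_comp (c j)

theorem fderiv_clm_comp (A : Form n →L[ℂ] Form n) (h : Differentiable ℝ φ)
    (x v : EuclideanSpace ℝ (Fin n)) :
    fderiv ℝ (fun y => A (φ y)) x v = A (fderiv ℝ φ x v) := by
  have e := ((A.restrictScalars ℝ).hasFDerivAt.comp x (h x).hasFDerivAt).fderiv
  exact congrArg (fun T => T v) e

theorem firstOrder_add (hφ : Differentiable ℝ φ) (hψ : Differentiable ℝ ψ)
    (x : EuclideanSpace ℝ (Fin n)) :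
    firstOrder c (fun x => φ x + ψ x) x = firstOrder c φ x + firstOrder c ψ x := by
  simp only [firstOrder]
  rw [← Finset.sum_add_distrib]
  refine Finset.sum_congr rfl fun j _ => ?_
  rw [fderiv_fun_add (hφ x) (hψ x), add_apply, map_add]

theorem firstOrder_clm_comp (A : Form n →L[ℂ] Form n) (h : Differentiable ℝ φ)
    (x : EuclideanSpace ℝ (Fin n)) :
    firstOrder c (fun x => A (φ x)) x =
      ∑ j, c j (A (fderiv ℝ φ x (EuclideanSpace.single j 1))) := by
  simp only [firstOrder, fderiv_clm_comp A h]

theorem firstOrder_translate (x v : EuclideanSpace ℝ (Fin n)) :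
    firstOrder c (fun x => φ (x + v)) x = firstOrder c φ (x + v) := by
  simp only [firstOrder, fderiv_comp_add_right]

/-- Anticommuting coefficients meet symmetric second derivatives, so the double sum equals its own
negative. -/
theorem firstOrder_firstOrder (hc : ∀ i j u, c i (c j u) = -c j (c i u)) (h : IsTestForm φ)
    (x : EuclideanSpace ℝ (Fin n)) : firstOrder c (firstOrder c φ) x = 0 := by
  let e : Fin n → EuclideanSpace ℝ (Fin n) := fun j => EuclideanSpace.single j 1
  have hd : Differentiable ℝ (fderiv ℝ φ) :=
    (h.smooth.fderiv_right (m := ∞) (by simp)).differentiable (by simp)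
  have h2 : ∀ i, fderiv ℝ (firstOrder c φ) x (e i) =
      ∑ j, c j (fderiv ℝ (fderiv ℝ φ) x (e i) (e j)) := by
    intro i
    have hj : ∀ j, Differentiable ℝ (fun y => fderiv ℝ φ y (e j)) := fun j =>
      hd.clm_apply (differentiable_const _)
    have e1 : fderiv ℝ (firstOrder c φ) x =
        ∑ j, fderiv ℝ (fun y => c j (fderiv ℝ φ y (e j))) x :=
      fderiv_fun_sum fun j _ => ((c j).restrictScalars ℝ).differentiableAt.comp x (hj j x)
    rw [e1, sum_apply]
    refine Finset.sum_congr rfl fun j _ => ?_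
    rw [fderiv_clm_comp (c j) (hj j), fderiv_clm_apply (hd x) (differentiableAt_const _)]
    simp
  have hs : ∀ i j, fderiv ℝ (fderiv ℝ φ) x (e i) (e j) = fderiv ℝ (fderiv ℝ φ) x (e j) (e i) := by
    intro i j
    exact (h.smooth.contDiffAt (x := x)).isSymmSndFDerivAt
      (by simpa using WithTop.coe_le_coe.2 (le_top : (2 : ℕ∞) ≤ ⊤)) (e i) (e j)
  have h3 : firstOrder c (firstOrder c φ) x =
      ∑ i, ∑ j, c i (c j (fderiv ℝ (fderiv ℝ φ) x (e i) (e j))) := by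
    change ∑ i, c i (fderiv ℝ (firstOrder c φ) x (e i)) = _
    simp only [h2, map_sum]
  have h4 : firstOrder c (firstOrder c φ) x = -firstOrder c (firstOrder c φ) x := by
    conv_lhs => rw [h3, Finset.sum_comm]
    rw [h3, ← Finset.sum_neg_distrib]
    refine Finset.sum_congr rfl fun i _ => ?_
    rw [← Finset.sum_neg_distrib]
    refine Finset.sum_congr rfl fun j _ => ?_
    rw [hc, hs]
  have h5 := add_eq_zero_iff_eq_neg.2 h4
  rw [← two_smul ℂ] at h5
  exact (smul_eq_zero.1 h5).resolve_left two_ne_zero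

/-- Cartan's formula for a constant coordinate field. -/
theorem fderiv_eq_cartan {c' : Fin n → Form n →L[ℂ] Form n}
    (hc : ∀ i j u, c i (c' j u) + c' j (c i u) = if i = j then u else 0) (h : IsTestForm φ)
    (i : Fin n) (x : EuclideanSpace ℝ (Fin n)) :
    fderiv ℝ φ x (EuclideanSpace.single i 1) =
      firstOrder c (fun y => c' i (φ y)) x + c' i (firstOrder c φ x) := by
  rw [firstOrder_clm_comp _ h.differentiable, firstOrder, map_sum, ← Finset.sum_add_distrib]
  simp only [hc, Finset.sum_ite_eq', Finset.mem_univ, if_true]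

end FirstOrder

/-! ### Double adjoints and closures. -/

section Closure

open scoped ComplexInnerProductSpace

variable {H : Type*} [NormedAddCommGroup H] [InnerProductSpace ℂ H] [CompleteSpace H]

/-- The second adjoint of a subspace of `H × H` is its closure. -/
theorem mem_closure_of_adjoint {G₀ G : Submodule ℂ (H × H)}
    (hG : ∀ y z, (y, z) ∈ G ↔ ∀ x w, (x, w) ∈ G₀ → ⟪w, y⟫ = ⟪x, z⟫) {x w : H}
    (h : ∀ y z, (y, z) ∈ G → ⟪z, x⟫ = ⟪y, w⟫) : (x, w) ∈ closure (G₀ : Set (H × H)) := by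
  let e := WithLp.prodContinuousLinearEquiv 2 ℂ H H
  let G' : Submodule ℂ (WithLp 2 (H × H)) := G₀.comap (e : WithLp 2 (H × H) →ₗ[ℂ] H × H)
  have h1 : e.symm (x, w) ∈ G'ᗮᗮ := by
    rw [Submodule.mem_orthogonal]
    intro p hp
    -- A quarter turn of `H × H` carries the orthogonal complement of a relation into its adjoint.
    have h2 : ((e p).2, -(e p).1) ∈ G := (hG _ _).2 fun s t hst => by
      have h3 : ⟪s, (e p).1⟫ + ⟪t, (e p).2⟫ = 0 :=
        (Submodule.mem_orthogonal _ _).1 hp (e.symm (s, t)) hst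
      rw [inner_neg_right]
      linear_combination h3
    have h4 := h _ _ h2
    rw [inner_neg_left] at h4
    change ⟪(e p).1, x⟫ + ⟪(e p).2, w⟫ = 0
    linear_combination -h4
  rw [Submodule.orthogonal_orthogonal_eq_closure] at h1
  have h2 : e (e.symm (x, w)) ∈ closure (G₀ : Set (H × H)) :=
    map_mem_closure e.continuous h1 fun p hp => hp
  exact h2

end Closure

/-! ### Weak first order operators -/

section WeakOperator

variable {n : ℕ}

theorem IsTestForm.memLp_firstOrder {φ : EuclideanSpace ℝ (Fin n) → Form n} (h : IsTestForm φ)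
    (c : Fin n → Form n →L[ℂ] Form n) : MemLp (firstOrder c φ) 2 (hMeasure n) :=
  (isTestForm_firstOrder h c).memLp

/-- The graph of a first order operator on test forms. -/
def testGraph (c : Fin n → Form n →L[ℂ] Form n) : Submodule ℂ (L2Form n × L2Form n) where
  carrier := {p | ∃ φ, IsTestForm φ ∧ p.1 =ᵐ[hMeasure n] φ ∧ p.2 =ᵐ[hMeasure n] firstOrder c φ}
  zero_mem' := by
    refine ⟨_, isTestForm_zero, Lp.coeFn_zero _ _ _, (Lp.coeFn_zero _ _ _).trans ?_⟩
    refine Filter.Eventually.of_forall fun x => ?_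
    simp [firstOrder]
  add_mem' := by
    rintro p q ⟨φ, hφ, h1, h2⟩ ⟨ψ, hψ, h3, h4⟩
    refine ⟨_, hφ.add hψ, ?_, ?_⟩
    · filter_upwards [h1, h3, Lp.coeFn_add p.1 q.1] with x e1 e2 e3
      rw [Prod.fst_add, e3, Pi.add_apply, e1, e2]
    · filter_upwards [h2, h4, Lp.coeFn_add p.2 q.2] with x e1 e2 e3
      rw [Prod.snd_add, e3, Pi.add_apply, e1, e2,
        firstOrder_add hφ.differentiable hψ.differentiable]
  smul_mem' := by
    rintro a p ⟨φ, hφ, h1, h2⟩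
    refine ⟨_, hφ.clm_comp (a • ContinuousLinearMap.id ℂ (Form n)), ?_, ?_⟩
    · filter_upwards [h1, Lp.coeFn_smul a p.1] with x e1 e2
      rw [Prod.smul_fst, e2, Pi.smul_apply, e1]
      rfl
    · filter_upwards [h2, Lp.coeFn_smul a p.2] with x e1 e2
      rw [Prod.smul_snd, e2, Pi.smul_apply, e1, firstOrder_clm_comp _ hφ.differentiable,
        firstOrder, Finset.smul_sum]
      simp

theorem IsTestForm.mem_testGraph {φ : EuclideanSpace ℝ (Fin n) → Form n} (h : IsTestForm φ)
    (c : Fin n → Form n →L[ℂ] Form n) :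
    (h.memLp.toLp φ, (h.memLp_firstOrder c).toLp _) ∈ testGraph c :=
  ⟨φ, h, h.memLp.coeFn_toLp, (h.memLp_firstOrder c).coeFn_toLp⟩

/-- `A` is the weak realization on `L²(ℝⁿ₊, Λ)` of the formal adjoint of the first order operator
with coefficients `c`. -/
def IsWeakRealization (c : Fin n → Form n →L[ℂ] Form n) (A : L2Form n →ₗ.[ℂ] L2Form n) : Prop :=
  ∀ u w, (u, w) ∈ A.graph ↔ ∀ φ : EuclideanSpace ℝ (Fin n) → Form n, IsTestForm φ →
    ∫ x in halfSpace n, inner ℂ (firstOrder c φ x) (u x) = ∫ x in halfSpace n, inner ℂ (φ x) (w x)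

variable {c c' : Fin n → Form n →L[ℂ] Form n} {A : L2Form n →ₗ.[ℂ] L2Form n}

theorem IsWeakRealization.mem_graph_iff (hA : IsWeakRealization c A) (u w : L2Form n) :
    (u, w) ∈ A.graph ↔ ∀ x y, (x, y) ∈ testGraph c → inner ℂ y u = inner ℂ x w := by
  rw [hA]
  constructor
  · rintro h x y ⟨φ, hφ, h1, h2⟩
    rw [L2.inner_def, L2.inner_def]
    refine Eq.trans ?_ ((h φ hφ).trans ?_)
    · refine integral_congr_ae ?_
      filter_upwards [h2] with x hx
      rw [hx]
    · refine integral_congr_ae ?_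
      filter_upwards [h1] with x hx
      rw [hx]
  · intro h φ hφ
    rw [integral_inner_eq (hφ.memLp_firstOrder c), integral_inner_eq hφ.memLp]
    exact h _ _ (hφ.mem_testGraph c)

theorem dense_testForms {u : L2Form n} {ε : ℝ} (hε : 0 < ε) :
    ∃ (φ : EuclideanSpace ℝ (Fin n) → Form n) (h : IsTestForm φ), ‖u - h.memLp.toLp φ‖ < ε := by
  -- With zero coefficients the first projection of the test graph is just the space of test forms.
  let S : Submodule ℂ (L2Form n) :=
    (testGraph (fun _ : Fin n => (0 : Form n →L[ℂ] Form n))).map (LinearMap.fst ℂ _ _)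
  have hS : S.topologicalClosure = ⊤ := by
    rw [Submodule.topologicalClosure_eq_top_iff, Submodule.eq_bot_iff]
    intro w hw
    refine eq_zero_of_forall_testForm fun φ hφ => ?_
    rw [integral_inner_eq hφ.memLp]
    exact (Submodule.mem_orthogonal _ _).1 hw _ ⟨_, hφ.mem_testGraph _, rfl⟩
  have hu : u ∈ S.topologicalClosure := hS ▸ trivial
  obtain ⟨v, ⟨⟨v', w⟩, ⟨φ, hφ, h1, -⟩, rfl⟩, hd⟩ := Metric.mem_closure_iff.1 hu ε hε
  refine ⟨φ, hφ, ?_⟩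
  have e : hφ.memLp.toLp φ = v' := Lp.ext ((MemLp.coeFn_toLp _).trans h1.symm)
  rw [e, ← dist_eq_norm]
  exact hd

theorem IsTestForm.setIntegral_eq {φ : EuclideanSpace ℝ (Fin n) → Form n} (h : IsTestForm φ)
    (f : EuclideanSpace ℝ (Fin n) → Form n) :
    ∫ x in halfSpace n, inner ℂ (φ x) (f x) = ∫ x, inner ℂ (φ x) (f x) := by
  refine setIntegral_eq_integral_of_forall_compl_eq_zero fun x hx => ?_
  rw [image_eq_zero_of_notMem_tsupport fun h' => hx (h.support h'), inner_zero_left]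

theorem integrable_inner {f g : EuclideanSpace ℝ (Fin n) → Form n} (hf : IsTestForm f)
    (hg : IsTestForm g) :
    Integrable (fun x => inner ℂ (f x) (g x)) :=
  (hf.smooth.continuous.inner hg.smooth.continuous).integrable_of_hasCompactSupport
    (hf.compact.mono fun x hx h0 => hx (by simp [h0]))

theorem integral_inner_fderiv {φ ψ : EuclideanSpace ℝ (Fin n) → Form n} (hφ : IsTestForm φ)
    (hψ : IsTestForm ψ) (v : EuclideanSpace ℝ (Fin n)) :
    ∫ x, inner ℂ (fderiv ℝ φ x v) (ψ x) = -∫ x, inner ℂ (φ x) (fderiv ℝ ψ x v) := by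
  have key := integral_bilinear_hasLineDerivAt_right_eq_neg_left_of_integrable
    (μ := volume) (v := v) (f := φ) (f' := fun x => fderiv ℝ φ x v) (g := ψ)
    (g' := fun x => fderiv ℝ ψ x v)
    (B := (isBoundedBilinearMap_inner (𝕜 := ℂ) (E := Form n)).toContinuousLinearMap)
    (integrable_inner (hφ.fderiv_apply v) hψ) (integrable_inner hφ (hψ.fderiv_apply v))
    (integrable_inner hφ hψ)
    (fun x _ => (hφ.differentiable x).hasFDerivAt.hasLineDerivAt v)
    (fun x _ => (hψ.differentiable x).hasFDerivAt.hasLineDerivAt v)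
  exact (neg_eq_iff_eq_neg.2 key).symm

theorem integral_inner_firstOrder (hadj : ∀ j u v, inner ℂ (c j u) v = inner ℂ u (c' j v))
    {φ ψ : EuclideanSpace ℝ (Fin n) → Form n} (hφ : IsTestForm φ) (hψ : IsTestForm ψ) :
    ∫ x, inner ℂ (firstOrder c φ x) (ψ x) =
      ∫ x, inner ℂ (φ x) (firstOrder (fun j => -c' j) ψ x) := by
  simp only [firstOrder, sum_inner, inner_sum]
  rw [integral_finsetSum, integral_finsetSum]
  · refine Finset.sum_congr rfl fun j _ => ?_
    simp only [hadj]
    rw [integral_inner_fderiv hφ (hψ.clm_comp (c' j)), ← integral_neg]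
    simp only [fderiv_clm_comp (c' j) hψ.differentiable, neg_apply, inner_neg_right]
  · exact fun j _ => integrable_inner hφ ((hψ.fderiv_apply _).clm_comp (-c' j))
  · exact fun j _ => integrable_inner ((hφ.fderiv_apply _).clm_comp (c j)) hψ

theorem IsWeakRealization.mem_graph_testForm (hA : IsWeakRealization c A)
    (hadj : ∀ j u v, inner ℂ (c j u) v = inner ℂ u (c' j v)) {φ : EuclideanSpace ℝ (Fin n) → Form n}
    (h : IsTestForm φ) :
    (h.memLp.toLp φ, (h.memLp_firstOrder fun j => -c' j).toLp _) ∈ A.graph := by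
  rw [hA]
  intro ψ hψ
  have e1 : ∫ x in halfSpace n, inner ℂ (firstOrder c ψ x) (h.memLp.toLp φ x) =
      ∫ x in halfSpace n, inner ℂ (firstOrder c ψ x) (φ x) := by
    refine integral_congr_ae ?_
    filter_upwards [h.memLp.coeFn_toLp] with x hx
    rw [hx]
  have e2 : ∫ x in halfSpace n, inner ℂ (ψ x)
        ((h.memLp_firstOrder fun j => -c' j).toLp _ x) =
      ∫ x in halfSpace n, inner ℂ (ψ x) (firstOrder (fun j => -c' j) φ x) := by
    refine integral_congr_ae ?_
    filter_upwards [(h.memLp_firstOrder fun j => -c' j).coeFn_toLp] with x hx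
    rw [hx]
  rw [e1, e2, IsTestForm.setIntegral_eq (isTestForm_firstOrder hψ c), hψ.setIntegral_eq,
    integral_inner_firstOrder hadj hψ h]

theorem IsWeakRealization.dense_domain (hA : IsWeakRealization c A)
    (hadj : ∀ j u v, inner ℂ (c j u) v = inner ℂ u (c' j v)) :
    Dense (A.domain : Set (L2Form n)) := by
  rw [Metric.dense_iff]
  intro u ε hε
  obtain ⟨φ, hφ, h⟩ := dense_testForms (u := u) hε
  refine ⟨hφ.memLp.toLp φ, ?_, LinearPMap.mem_domain_of_mem_graph (hA.mem_graph_testForm hadj hφ)⟩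
  rwa [Metric.mem_ball, dist_comm, dist_eq_norm]

theorem IsWeakRealization.mapsDegree (hA : IsWeakRealization c A) {k l : ℤ}
    (hc : ∀ j u, c j (degProj n l u) = degProj n k (c j u)) : MapsDegree A k l := by
  intro u w h
  rw [hA] at h ⊢
  intro φ hφ
  have e1 : ∫ x in halfSpace n, inner ℂ (firstOrder c φ x) (l2Proj n k u x) =
      ∫ x in halfSpace n, inner ℂ (firstOrder c (fun x => degProj n l (φ x)) x) (u x) := by
    refine integral_congr_ae ?_
    filter_upwards [coeFn_l2Proj k u] with x hx
    rw [hx, ← inner_degProj, firstOrder_clm_comp _ hφ.differentiable, firstOrder, map_sum]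
    simp only [hc]
  have e2 : ∫ x in halfSpace n, inner ℂ (φ x) (l2Proj n l w x) =
      ∫ x in halfSpace n, inner ℂ (degProj n l (φ x)) (w x) := by
    refine integral_congr_ae ?_
    filter_upwards [coeFn_l2Proj l w] with x hx
    rw [hx, ← inner_degProj]
  rw [e1, e2]
  exact h _ (hφ.clm_comp _)

/-- Testing `w` against `firstOrder c φ`, itself the image of a test form, moves a second copy of
the operator onto `φ`, where it gives zero. -/
theorem IsWeakRealization.nilpotent (hA : IsWeakRealization c A)
    (hc : ∀ i j u, c i (c j u) = -c j (c i u)) (u w : L2Form n) (h : (u, w) ∈ A.graph) :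
    w ∈ kernel A := by
  rw [mem_kernel, hA]
  rw [hA] at h
  intro φ hφ
  rw [← h _ (isTestForm_firstOrder hφ c)]
  simp only [firstOrder_firstOrder hc hφ, inner_zero_left, integral_zero]
  symm
  refine integral_eq_zero_of_ae ?_
  filter_upwards [Lp.coeFn_zero (Form n) 2 (hMeasure n)] with x hx
  rw [hx, Pi.zero_apply, inner_zero_right, Pi.zero_apply]

end WeakOperator

/-! ### Tangential translations -/

section Translation

variable {n : ℕ}

/-- Vectors parallel to the boundary of the half-space. -/
def IsTangential (v : EuclideanSpace ℝ (Fin n)) : Prop := ∀ i : Fin n, (i : ℕ) + 1 = n → v i = 0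

variable {v : EuclideanSpace ℝ (Fin n)} {c c' : Fin n → Form n →L[ℂ] Form n}
  {A : L2Form n →ₗ.[ℂ] L2Form n}

theorem IsTangential.smul (hv : IsTangential v) (t : ℝ) : IsTangential (t • v) := fun i hi => by
  rw [PiLp.smul_apply, hv i hi, smul_zero]

theorem IsTangential.preimage (hv : IsTangential v) :
    (fun x => x + v) ⁻¹' halfSpace n = halfSpace n := by
  ext x
  refine forall₂_congr fun i hi => ?_
  rw [PiLp.add_apply, hv i hi, add_zero]

theorem IsTangential.measurePreserving (hv : IsTangential v) :
    MeasurePreserving (fun x => x + v) (hMeasure n) (hMeasure n) := by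
  have h := (measurePreserving_add_right (volume : Measure (EuclideanSpace ℝ (Fin n)))
    v).restrict_preimage (halfSpace_isOpen n).measurableSet
  rwa [hv.preimage] at h

/-- Translation of `L²` forms by a tangential vector. -/
def translate (hv : IsTangential v) : L2Form n →ₗᵢ[ℂ] L2Form n :=
  Lp.compMeasurePreservingₗᵢ ℂ (fun x => x + v) hv.measurePreserving

theorem coeFn_translate (hv : IsTangential v) (u : L2Form n) :
    ∀ᵐ x ∂(hMeasure n), translate hv u x = u (x + v) :=
  Lp.coeFn_compMeasurePreserving u hv.measurePreserving

theorem translate_ae_eq (hv : IsTangential v) {u : L2Form n} {φ : EuclideanSpace ℝ (Fin n) → Form n}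
    (h : u =ᵐ[hMeasure n] φ) : translate hv u =ᵐ[hMeasure n] fun x => φ (x + v) := by
  filter_upwards [coeFn_translate hv u,
    hv.measurePreserving.quasiMeasurePreserving.ae h] with x h1 h2
  rw [h1, h2]

theorem IsTestForm.comp_add {φ : EuclideanSpace ℝ (Fin n) → Form n} (h : IsTestForm φ)
    (hv : IsTangential v) :
    IsTestForm (fun x => φ (x + v)) where
  smooth := h.smooth.comp (contDiff_id.add contDiff_const)
  compact := h.compact.comp_homeomorph (Homeomorph.addRight v)
  support := (tsupport_comp_subset_preimage φ (by fun_prop)).trans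
    ((Set.preimage_mono h.support).trans hv.preimage.subset)

theorem integrable_inner_of_memLp {f : EuclideanSpace ℝ (Fin n) → Form n}
    (hf : MemLp f 2 (hMeasure n)) (u : L2Form n) :
    Integrable (fun x => inner ℂ (f x) (u x)) (hMeasure n) := by
  refine (L2.integrable_inner (𝕜 := ℂ) (hf.toLp f) u).congr ?_
  filter_upwards [hf.coeFn_toLp] with x hx
  rw [hx]

/-- Differentiation of `t ↦ ⟨φ(· + t v), u⟩`. -/
theorem IsTestForm.hasDerivAt_integral_translate {φ : EuclideanSpace ℝ (Fin n) → Form n}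
    (h : IsTestForm φ) (v : EuclideanSpace ℝ (Fin n))
    (u : L2Form n) (t : ℝ) :
    HasDerivAt (fun t : ℝ => ∫ x in halfSpace n, inner ℂ (φ (x + t • v)) (u x))
      (∫ x in halfSpace n, inner ℂ (fderiv ℝ φ (x + t • v) v) (u x)) t := by
  have hu : AEStronglyMeasurable u (hMeasure n) := (Lp.memLp u).1
  have hd := h.fderiv_apply v
  obtain ⟨C, hC⟩ := hd.compact.exists_bound_of_continuous hd.smooth.continuous
  -- A compact set containing the supports of all translates with `|s - t| ≤ 1`. On it the `L²` form
  -- `u` is integrable, which supplies the dominating function.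
  let K : Set (EuclideanSpace ℝ (Fin n)) :=
    Set.image (fun p : EuclideanSpace ℝ (Fin n) × ℝ => p.1 - p.2 • v)
      (tsupport φ ×ˢ Set.Icc (t - 1) (t + 1))
  have hK : IsCompact K := (h.compact.isCompact.prod isCompact_Icc).image (by fun_prop)
  have hKm : MeasurableSet K := hK.isClosed.measurableSet
  have hint : IntegrableOn (fun x => C * ‖u x‖) K (hMeasure n) :=
    (((Lp.memLp u).locallyIntegrable (by norm_num)).integrableOn_isCompact hK).norm.const_mul C
  have hcomp : ∀ s : ℝ, HasCompactSupport (fun x => φ (x + s • v)) := fun s =>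
    h.compact.comp_homeomorph (Homeomorph.addRight (s • v))
  have hmem : ∀ s : ℝ, MemLp (fun x => φ (x + s • v)) 2 (hMeasure n) := fun s =>
    ((h.smooth.continuous.comp (continuous_add_const _)).memLp_of_hasCompactSupport
      (hcomp s)).restrict _
  refine (hasDerivAt_integral_of_dominated_loc_of_deriv_le
    (F := fun (s : ℝ) x => inner ℂ (φ (x + s • v)) (u x))
    (F' := fun (s : ℝ) x => inner ℂ (fderiv ℝ φ (x + s • v) v) (u x))
    (bound := K.indicator fun x => C * ‖u x‖)
    (Icc_mem_nhds (sub_one_lt t) (lt_add_one t)) (Filter.Eventually.of_forall fun s => ?_) ?_ ?_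
    (Filter.Eventually.of_forall fun x s hs => ?_) (hint.integrable_indicator hKm)
    (Filter.Eventually.of_forall fun x s hs => ?_)).2
  · exact (hmem s).1.inner hu
  · exact integrable_inner_of_memLp (hmem t) u
  · exact (hd.smooth.continuous.comp (continuous_add_const _)).aestronglyMeasurable.inner hu
  · by_cases hx : x ∈ K
    · rw [Set.indicator_of_mem hx]
      exact (norm_inner_le_norm _ _).trans (mul_le_mul_of_nonneg_right (hC _) (norm_nonneg _))
    · have h0 : fderiv ℝ φ (x + s • v) v = 0 := by
        by_contra hne
        refine hx ⟨(x + s • v, s), ⟨?_, hs⟩, by simp⟩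
        exact tsupport_fderiv_apply_subset ℝ v (subset_tsupport _ hne)
      rw [h0, inner_zero_left, norm_zero, Set.indicator_of_notMem hx]
  · have e1 : HasDerivAt (fun s : ℝ => x + s • v) v s := by
      simpa using ((hasDerivAt_id s).smul_const v).const_add x
    have e2 : HasDerivAt (fun s : ℝ => φ (x + s • v)) (fderiv ℝ φ (x + s • v) v) s :=
      (h.differentiable _).hasFDerivAt.comp_hasDerivAt s e1
    simpa using e2.inner ℂ (hasDerivAt_const s (u x))

/-- Translations move test forms weakly, on the kernel of `A`, only as far as the first order
operator allows. -/
theorem IsWeakRealization.translate_estimate (hA : IsWeakRealization c A)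
    (hc : ∀ i j u, c i (c' j u) + c' j (c i u) = if i = j then u else 0) {i : Fin n}
    (hv : IsTangential (EuclideanSpace.single i (1 : ℝ))) {u : L2Form n} (hu : u ∈ kernel A)
    {t : ℝ} (ht : 0 ≤ t) {p : L2Form n × L2Form n} (hp : p ∈ testGraph c) :
    ‖inner ℂ (translate (hv.smul t) p.1) u - inner ℂ p.1 u‖ ≤
      ‖(c' i).compLpL 2 (hMeasure n)‖ * ‖p.2‖ * ‖u‖ * t := by
  obtain ⟨φ, hφ, h1, h2⟩ := hp
  set v : EuclideanSpace ℝ (Fin n) := EuclideanSpace.single i 1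
  let f : ℝ → ℂ := fun t => ∫ x in halfSpace n, inner ℂ (φ (x + t • v)) (u x)
  have hf : ∀ t, f t = inner ℂ (translate (hv.smul t) p.1) u := fun t => by
    rw [L2.inner_def]
    refine integral_congr_ae ?_
    filter_upwards [translate_ae_eq (hv.smul t) h1] with x hx
    rw [hx]
  have hf0 : f 0 = inner ℂ p.1 u := by
    rw [L2.inner_def]
    refine integral_congr_ae ?_
    filter_upwards [h1] with x hx
    rw [hx, zero_smul, add_zero]
  have hf' : ∀ s, HasDerivAt f
      (inner ℂ ((c' i).compLpL 2 (hMeasure n) (translate (hv.smul s) p.2)) u) s := by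
    intro s
    have hφs := hφ.comp_add (hv.smul s)
    have e := hφ.hasDerivAt_integral_translate v u s
    have e1 : ∫ x in halfSpace n, inner ℂ (fderiv ℝ φ (x + s • v) v) (u x) =
        ∫ x in halfSpace n,
          (inner ℂ (firstOrder c (fun y => c' i (φ (y + s • v))) x) (u x) +
            inner ℂ (((c' i).compLpL 2 (hMeasure n) (translate (hv.smul s) p.2)) x) (u x)) := by
      refine integral_congr_ae ?_
      filter_upwards [(c' i).coeFn_compLpL (translate (hv.smul s) p.2),
        translate_ae_eq (hv.smul s) h2] with x e1 e2
      rw [← inner_add_left, e1, e2, ← firstOrder_translate, ← fderiv_eq_cartan hc hφs i x,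
        fderiv_comp_add_right]
    -- The first Cartan term is the operator applied to a test form, so it pairs to zero with `u ∈
    -- ker A`.
    have e2 : ∫ x in halfSpace n,
        inner ℂ (firstOrder c (fun y => c' i (φ (y + s • v))) x) (u x) = 0 := by
      rw [(hA u 0).1 hu _ (hφs.clm_comp (c' i))]
      refine integral_eq_zero_of_ae ?_
      filter_upwards [Lp.coeFn_zero (Form n) 2 (hMeasure n)] with x hx
      rw [hx, Pi.zero_apply, inner_zero_right, Pi.zero_apply]
    rw [e1, integral_add, e2, zero_add, ← L2.inner_def] at e
    · exact e
    · exact integrable_inner_of_memLp ((hφs.clm_comp (c' i)).memLp_firstOrder c) u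
    · exact L2.integrable_inner _ u
  rw [← hf, ← hf0]
  have key := norm_image_sub_le_of_norm_deriv_le_segment' (a := 0) (b := t)
    (fun s _ => (hf' s).hasDerivWithinAt)
    (C := ‖(c' i).compLpL 2 (hMeasure n)‖ * ‖p.2‖ * ‖u‖) (fun s _ => ?_) t
    (Set.right_mem_Icc.2 ht)
  · rwa [sub_zero] at key
  · refine (norm_inner_le_norm _ _).trans (mul_le_mul_of_nonneg_right ?_ (norm_nonneg _))
    refine (ContinuousLinearMap.le_opNorm _ _).trans_eq ?_
    rw [LinearIsometry.norm_map]

/-- Tangential translations of a test form become orthogonal to it. -/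
theorem IsTestForm.exists_translate_orthogonal {φ : EuclideanSpace ℝ (Fin n) → Form n}
    (h : IsTestForm φ) {i : Fin n}
    (hv : IsTangential (EuclideanSpace.single i (1 : ℝ))) :
    ∃ t : ℝ, ∃ _ : 0 ≤ t,
      inner ℂ (translate (hv.smul t) (h.memLp.toLp φ)) (h.memLp.toLp φ) = 0 := by
  obtain ⟨r, hr⟩ := h.compact.isCompact.isBounded.subset_closedBall 0
  have hr' : ∀ x, φ x ≠ 0 → ‖x‖ ≤ r := fun x hx => by
    simpa using hr (subset_tsupport _ hx)
  -- A shift longer than the diameter of a ball containing the support makes the supports disjoint.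
  refine ⟨2 * |r| + 1, by positivity, ?_⟩
  rw [L2.inner_def]
  refine integral_eq_zero_of_ae ?_
  filter_upwards [translate_ae_eq (hv.smul (2 * |r| + 1)) h.memLp.coeFn_toLp,
    h.memLp.coeFn_toLp] with x h1 h2
  rw [h1, h2, Pi.zero_apply]
  by_cases hx : φ x = 0
  · rw [hx, inner_zero_right]
  by_cases hy : φ (x + (2 * |r| + 1) • EuclideanSpace.single i (1 : ℝ)) = 0
  · rw [hy, inner_zero_left]
  exfalso
  have e1 := hr' _ hx
  have e2 := hr' _ hy
  have e3 := norm_sub_le (x + (2 * |r| + 1) • EuclideanSpace.single i (1 : ℝ)) x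
  rw [add_sub_cancel_left, norm_smul, PiLp.norm_single, norm_one, mul_one,
    Real.norm_of_nonneg (by positivity)] at e3
  linarith [le_abs_self r]

/-- This is where the geometry enters: `u` is a graph limit of test forms whose images tend to zero,
so the translation estimate forces `⟨τ_t u, u⟩ = ‖u‖²` for all `t ≥ 0`. Translations that separate
supports contradict this unless `u = 0`. -/
theorem IsWeakRealization.kernel_disjoint (hA : IsWeakRealization c A)
    (hadj : ∀ j u v, inner ℂ (c j u) v = inner ℂ u (c' j v))
    (hc : ∀ i j u, c i (c' j u) + c' j (c i u) = if i = j then u else 0) {i : Fin n}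
    (hv : IsTangential (EuclideanSpace.single i (1 : ℝ))) {u : L2Form n} (hu : u ∈ kernel A)
    (hu' : u ∈ kernel A.adjoint) : u = 0 := by
  have hd := hA.dense_domain hadj
  have hcl : (u, (0 : L2Form n)) ∈ closure (testGraph c : Set (L2Form n × L2Form n)) := by
    refine mem_closure_of_adjoint hA.mem_graph_iff fun y z hy => ?_
    exact (mem_graph_adjoint_iff hd _ _).1 hu' y z hy
  have hinv : ∀ (t : ℝ) (_ : 0 ≤ t), inner ℂ (translate (hv.smul t) u) u = inner ℂ u u := by
    intro t ht
    have h1 : IsClosed {p : L2Form n × L2Form n |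
        ‖inner ℂ (translate (hv.smul t) p.1) u - inner ℂ p.1 u‖ ≤
          ‖(c' i).compLpL 2 (hMeasure n)‖ * ‖p.2‖ * ‖u‖ * t} := by
      have := (translate (hv.smul t)).continuous
      exact isClosed_le (by fun_prop) (by fun_prop)
    have h2 := h1.closure_subset_iff.2 (fun p hp => hA.translate_estimate hc hv hu ht hp) hcl
    have h3 : ‖inner ℂ (translate (hv.smul t) u) u - inner ℂ u u‖ ≤ 0 := by
      simpa using h2
    exact sub_eq_zero.1 (norm_le_zero_iff.1 h3)
  by_contra hne
  have hpos : 0 < ‖u‖ := norm_pos_iff.2 hne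
  -- With `ε = ‖u - f‖ < ‖u‖ / 4`, the bound `‖u‖² ≤ ε (2‖u‖ + ε)` obtained below is less than
  -- `(9/16) ‖u‖²`.
  obtain ⟨φ, hφ, hlt⟩ := dense_testForms (u := u) (ε := ‖u‖ / 4) (by positivity)
  obtain ⟨t, ht, horth⟩ := hφ.exists_translate_orthogonal hv
  set f := hφ.memLp.toLp φ
  set τ := translate (hv.smul t)
  have e1 : inner ℂ u u = inner ℂ (τ (u - f)) u + inner ℂ (τ f) (u - f) := by
    rw [← hinv t ht, map_sub, inner_sub_left, inner_sub_right, horth]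
    ring
  have e2 : ‖u‖ ^ 2 ≤ ‖u - f‖ * ‖u‖ + ‖f‖ * ‖u - f‖ := by
    calc ‖u‖ ^ 2 = ‖inner ℂ u u‖ := by
          rw [inner_self_eq_norm_sq_to_K, norm_pow]
          simp
      _ ≤ ‖inner ℂ (τ (u - f)) u‖ + ‖inner ℂ (τ f) (u - f)‖ := by
          rw [e1]; exact norm_add_le _ _
      _ ≤ ‖τ (u - f)‖ * ‖u‖ + ‖τ f‖ * ‖u - f‖ :=
          add_le_add (norm_inner_le_norm _ _) (norm_inner_le_norm _ _)
      _ = ‖u - f‖ * ‖u‖ + ‖f‖ * ‖u - f‖ := by rw [τ.norm_map, τ.norm_map]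
  have e3 : ‖f‖ ≤ ‖u‖ + ‖u - f‖ := by
    have := norm_sub_le u (u - f)
    rwa [sub_sub_cancel] at this
  nlinarith [norm_nonneg (u - f), norm_nonneg f]

/-- `A` is itself the adjoint of the operator on test forms, and `A*` extends that operator; this
gives `A** = A`. -/
theorem IsWeakRealization.hodgePair (hn : 2 ≤ n) (hA : IsWeakRealization c A)
    (hadj : ∀ j u v, inner ℂ (c j u) v = inner ℂ u (c' j v))
    (hc : ∀ i j u, c i (c' j u) + c' j (c i u) = if i = j then u else 0)
    (hanti : ∀ i j u, c i (c j u) = -c j (c i u)) : HodgePair A A.adjoint := by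
  have hd := hA.dense_domain hadj
  -- For `n ≥ 2` the first coordinate is not the last one, so its direction is parallel to the
  -- boundary.
  have hv : IsTangential (EuclideanSpace.single (⟨0, by omega⟩ : Fin n) (1 : ℝ)) := by
    intro i hi
    have : i ≠ ⟨0, by omega⟩ := fun h => by simp only [h, zero_add] at hi; omega
    simp [this]
  refine ⟨mem_graph_adjoint_iff hd, fun y z => ⟨fun h x w hx => ?_, fun h => ?_⟩,
    hA.nilpotent hanti, fun u hu hu' => hA.kernel_disjoint hadj hc hv hu hu'⟩
  · have := (mem_graph_adjoint_iff hd _ _).1 hx _ _ h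
    rw [← inner_conj_symm w, ← this, inner_conj_symm]
  · refine (hA.mem_graph_iff y z).2 fun x w hx => h x w ?_
    refine (mem_graph_adjoint_iff hd _ _).2 fun s r hs => ?_
    have := (hA.mem_graph_iff _ _).1 hs _ _ hx
    rw [← inner_conj_symm r, ← this, inner_conj_symm]

end Translation

/-! ### The exterior and interior derivatives -/

section Derivatives

variable {n : ℕ}

/-- The exterior product as a bounded operator. -/
def wedgeCLM (j : Fin n) : Form n →L[ℂ] Form n := LinearMap.toContinuousLinearMap (wedge j)

/-- The interior product as a bounded operator. -/
def contractCLM (j : Fin n) : Form n →L[ℂ] Form n := LinearMap.toContinuousLinearMap (contract j)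

theorem inner_contract_left (j : Fin n) (u v : Form n) :
    inner ℂ (contract j u) v = inner ℂ u (wedge j v) := by
  rw [← inner_conj_symm, ← inner_wedge_left, inner_conj_symm]

theorem isWeakRealization_d : IsWeakRealization (fun j : Fin n => -contractCLM j) (dOp n) := by
  intro u w
  rw [mem_graph_d]
  have : ∀ φ : EuclideanSpace ℝ (Fin n) → Form n,
      firstOrder (fun j : Fin n => -contractCLM j) φ = coDiff φ := fun φ => by
    funext x
    exact Finset.sum_neg_distrib _
  simp only [this]
  rfl

theorem isWeakRealization_delta : IsWeakRealization (fun j : Fin n => wedgeCLM j) (deltaOp n) :=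
  fun u w => mem_graph_delta (u, w)

theorem hodgePair_d (hn : 2 ≤ n) : HodgePair (dOp n) (dStar n) := by
  refine isWeakRealization_d.hodgePair (c' := fun j => -wedgeCLM j) hn (fun j u v => ?_)
    (fun i j u => ?_) (fun i j u => ?_)
  · change inner ℂ (-contract j u) v = inner ℂ u (-wedge j v)
    rw [inner_neg_left, inner_neg_right, inner_contract_left]
  · change -contract i (-wedge j u) + -wedge j (-contract i u) = _
    rw [map_neg, map_neg, neg_neg, neg_neg, contract_wedge]
  · change -contract i (-contract j u) = -(-contract j (-contract i u))
    rw [map_neg, map_neg, neg_neg, neg_neg, contract_contract]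

theorem hodgePair_delta (hn : 2 ≤ n) : HodgePair (deltaOp n) (deltaStar n) := by
  refine isWeakRealization_delta.hodgePair (c' := fun j => contractCLM j) hn (fun j u v => ?_)
    (fun i j u => ?_) (fun i j u => ?_)
  · exact inner_wedge_left j u v
  · change wedge i (contract j u) + contract j (wedge i u) = _
    rw [add_comm, contract_wedge]
    simp only [eq_comm]
  · exact wedge_wedge i j u

theorem mapsDegree_d (k : ℤ) : MapsDegree (dOp n) k (k + 1) := by
  refine isWeakRealization_d.mapsDegree fun j u => ?_
  change -contract j (degProj n (k + 1) u) = degProj n k (-contract j u)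
  rw [degProj_contract, map_neg]

theorem mapsDegree_delta (k : ℤ) : MapsDegree (deltaOp n) (k + 1) k :=
  isWeakRealization_delta.mapsDegree fun j u => degProj_wedge j k u

end Derivatives

end HodgeHalfSpace

end

/-! ### The two boundary conditions on the half-space. -/

theorem theorem2p11 (n : ℕ) (hn : 2 ≤ n) (k : ℕ) (hk : k ≤ n) :
    -- tangential case
    (nullForms (dOp n) k = (imageForms (dOp n) (k - 1)).topologicalClosure ∧
      nullForms (dStar n) k = (imageForms (dStar n) (k + 1)).topologicalClosure ∧
      IsNonnegSqrt (negLaplaceT n) (sqrtOp (negLaplaceT n)) ∧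
      LinearMap.ker (sqrtOp (negLaplaceT n)).toFun = ⊥ ∧
      (∃ (_ : (nullForms (dStar n) k).HasOrthogonalProjection)
        (R S : L2Form n →L[ℂ] L2Form n),
        IsBoundedClosure (opComp (dOp n) (negHalfPow (negLaplaceT n))) R ∧
        IsBoundedClosure (opComp (dStar n) (negHalfPow (negLaplaceT n))) S ∧
        ∀ f ∈ L2Deg n k, (nullForms (dStar n) k).starProjection f = f - R (S f)) ∧
      nullForms (dStar n) k ⟂ nullForms (dOp n) k ∧
      nullForms (dStar n) k ⊔ nullForms (dOp n) k = L2Deg n k) ∧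
    -- normal case
    (nullForms (deltaStar n) k = (imageForms (deltaStar n) (k - 1)).topologicalClosure ∧
      nullForms (deltaOp n) k = (imageForms (deltaOp n) (k + 1)).topologicalClosure ∧
      IsNonnegSqrt (negLaplaceN n) (sqrtOp (negLaplaceN n)) ∧
      LinearMap.ker (sqrtOp (negLaplaceN n)).toFun = ⊥ ∧
      (∃ (_ : (nullForms (deltaOp n) k).HasOrthogonalProjection)
        (R S : L2Form n →L[ℂ] L2Form n),
        IsBoundedClosure (opComp (deltaStar n) (negHalfPow (negLaplaceN n))) R ∧
        IsBoundedClosure (opComp (deltaOp n) (negHalfPow (negLaplaceN n))) S ∧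
        ∀ f ∈ L2Deg n k, (nullForms (deltaOp n) k).starProjection f = f - R (S f)) ∧
      nullForms (deltaOp n) k ⟂ nullForms (deltaStar n) k ∧
      nullForms (deltaOp n) k ⊔ nullForms (deltaStar n) k = L2Deg n k) := by
  exact ⟨(hodgePair_d hn).decomposition mapsDegree_d k,
    -- The degree-raising operator must come first, so the pair `(δ, δ*)` is used in reversed order.
    (hodgePair_delta hn).symm.decomposition
      (fun k => (mapsDegree_delta k).adjoint (hodgePair_delta hn)) k⟩
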